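/- For $x_0\in\mathbb R^2$ and $R\ge 0$ let $B^R_{x_0}=\{x\in\mathbb R^2:|x-x_0|<R\}$. Let $L^2_b(\mathbb R^2)$ be the space of vector fields $u\in L^2_{loc}(\mathbb R^2;\mathbb R^2)$ with $$\|u\|_{L^2_b}:=\sup_{x_0\in\mathbb R^2}\|u\|_{L^2(B^1_{x_0})}<\infty,$$ and let $\dot L^2_b(\mathbb R^2)$ be the subspace of those $u\in L^2_b(\mathbb R^2)$ with $\lim_{|x_0|\to\infty}\|u\|_{L^2(B^1_{x_0})}=0$. "Divergence free" is meant in the sense of distributions. There is an absolute constant $C$ with the following property. For every divergence-free $u\in L^2_b(\mathbb R^2)$ there is a sequence $u^N\in L^2_b(\mathbb R^2)$, $N\in\mathbb N$, of divergence-free vector fields such that, for every $N$, $$\|u^N\|_{L^2_b}\le C\|u\|_{L^2_b},\qquad \operatorname{supp}u^N\subset B^{2N}_0,\qquad u^N(x)=u(x)\ \text{ for } x\in B^N_0 .$$ If, in addition, $u\in\dot L^2_b(\mathbb R^2)$, then the same sequence satisfies $$\lim_{|x_0|\to\infty}\|u^N\|_{L^2(B^1_{x_0})}=0\quad\text{uniformly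 with respect to } N .$$ -/

import Mathlib

open MeasureTheory Filter Topology
open scoped ENNReal NNReal ContDiff

namespace UniformlyLocal

/-- The Euclidean plane `ℝ²`. -/
abbrev Plane : Type := EuclideanSpace ℝ (Fin 2)

/-- The norm `‖u‖_{L²(B¹_{x₀})}` of a vector field on the unit ball centred at `x₀`,
as an extended nonnegative number. -/
noncomputable def localNorm (u : Plane → Plane) (x₀ : Plane) : ℝ≥0∞ :=
  eLpNorm u 2 (volume.restrict (Metric.ball x₀ 1))

/-- The uniformly local norm `‖u‖_{L²_b} = sup_{x₀ ∈ ℝ²} ‖u‖_{L²(B¹_{x₀})}`,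
as an extended nonnegative number. -/
noncomputable def ulNorm (u : Plane → Plane) : ℝ≥0∞ :=
  ⨆ x₀ : Plane, localNorm u x₀

/-- `u ∈ L²_b(ℝ²)`: `u` is in `L²_loc(ℝ²)` and its uniformly local norm is finite. -/
structure MemL2b (u : Plane → Plane) : Prop where
  memLp_of_isCompact : ∀ K : Set Plane, IsCompact K → MemLp u 2 (volume.restrict K)
  ulNorm_lt_top : ulNorm u < ⊤

/-- `u` is in the subspace of `L²_b(ℝ²)` of fields that tend to zero at infinity:
`‖u‖_{L²(B¹_{x₀})} → 0` as `|x₀| → ∞`. -/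
structure MemL2bDot (u : Plane → Plane) : Prop where
  memL2b : MemL2b u
  tendsto_zero : Tendsto (localNorm u) (cocompact Plane) (𝓝 0)

/-- `div u = 0` in the sense of distributions: `u` is locally integrable and
`∫ u · ∇φ = 0` for every real test function `φ ∈ C_c^∞(ℝ²)`
(`fderiv ℝ φ x (u x)` is `u(x) · ∇φ(x)`). -/
structure IsDivFree (u : Plane → Plane) : Prop where
  locallyIntegrable : LocallyIntegrable u volume
  integral_eq_zero : ∀ φ : Plane → ℝ, ContDiff ℝ ∞ φ → HasCompactSupport φ →
    ∫ x, fderiv ℝ φ x (u x) = 0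

end UniformlyLocal

/-! A planar divergence-free field has a stream function: `∂₁ψ = u₂` and `∂₂ψ = -u₁`. With smooth
cutoffs `χ_N` equal to 1 on the ball of radius `N`, supported in that of radius `2N`, and with
gradient at most `D/N`, take `u^N = ∇^⊥(χ_N ψ) = χ_N u + ψ ∇^⊥χ_N`. It is divergence free because it
is a perpendicular gradient, and it equals `u` where `χ_N = 1`. Only `ψ ∇^⊥χ_N` has to be estimated,
and for this it suffices that `‖ψ‖²` on unit balls centred within distance of order `N` from the
origin is at most `const · N² · B`, where `B` controls the mean energy of `u` over long rows and
columns of unit squares.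

Formally `ψ(x,y)` is the integral of `u₂` along a horizontal segment from `(a,y)` to `(x,y)`, minus
the integral of `u₁` along a vertical segment from `(a,b)` to `(a,y)`. An `L²` field has no trace on
a fixed line, so `a` and `b` are averaged over `[0,1]` with the weight `-step'`; this average is
what `ker` encodes. Cauchy–Schwarz on a segment of length `2n` costs a factor `2n`, and summing the
energies of about `2n` unit squares costs another, which gives `n² B` (`lintegral_box_stream_le`).
The weak derivatives of `ψ` follow by duality: Fubini moves the kernel to the test function, and the
transposed operator `dualPrim` preserves `C_c^∞`, so its output may be inserted in the divergence
condition (`integral_stream_mul_fderiv_snd`).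

If the local energies vanish at infinity, their means over long rows and columns become small
(`exists_nat_sum_le`). Since `u^N` vanishes near `x₀` unless `‖x₀‖ < 2N + 1`, a distant `x₀` sees
only large `N`, hence the uniformity. -/

open scoped Convolution

namespace UniformlyLocal


/-! ### Convolution in one variable with the other as a parameter -/

/-- Convolution in the first variable only, as a function on the plane. -/
noncomputable def convFst (f : ℝ → ℝ) (g : ℝ × ℝ → ℝ) (z : ℝ × ℝ) : ℝ :=
  ∫ x, f (z.1 - x) * g (x, z.2)

theorem convFst_eq_convolution (f : ℝ → ℝ) (g : ℝ × ℝ → ℝ) :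
    convFst f g = fun z : ℝ × ℝ =>
      (fun q : ℝ × ℝ => (f ⋆[ContinuousLinearMap.lsmul ℝ ℝ, volume]
        (fun p x => g (x, p) : ℝ → ℝ → ℝ) q.1) q.2) (z.2, z.1) := by
  funext z
  simp [convFst, convolution_eq_swap]

theorem exists_compact_slices {g : ℝ × ℝ → ℝ} (hc : HasCompactSupport g) :
    ∃ k : Set ℝ, IsCompact k ∧ ∀ y x, x ∉ k → g (x, y) = 0 := by
  refine ⟨Prod.fst '' tsupport g, hc.isCompact.image continuous_fst, fun y x hx => ?_⟩
  by_contra h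
  exact hx ⟨(x, y), subset_tsupport g h, rfl⟩

/-- All derivatives fall on `g`, so `f` may be rough; the case needed is the indicator of a
half-line. -/
theorem contDiff_convFst {f : ℝ → ℝ} {g : ℝ × ℝ → ℝ} (hf : LocallyIntegrable f)
    (hg : ContDiff ℝ ∞ g) (hc : HasCompactSupport g) : ContDiff ℝ ∞ (convFst f g) := by
  obtain ⟨k, hk, hgk⟩ := exists_compact_slices hc
  rw [convFst_eq_convolution]
  have h := contDiffOn_convolution_right_with_param (μ := volume) (n := ⊤) (s := Set.univ)
    (ContinuousLinearMap.lsmul ℝ ℝ) (g := fun p x => g (x, p)) isOpen_univ hk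
    (fun p x _ => hgk p x) hf (hg.comp (contDiff_snd.prodMk contDiff_fst)).contDiffOn
  rw [Set.univ_prod_univ, contDiffOn_univ] at h
  exact h.comp (contDiff_snd.prodMk contDiff_fst)

theorem fderiv_convFst {f : ℝ → ℝ} {g : ℝ × ℝ → ℝ} (hf : LocallyIntegrable f)
    (hg : ContDiff ℝ ∞ g) (hc : HasCompactSupport g) (z w : ℝ × ℝ) :
    fderiv ℝ (convFst f g) z w = convFst f (fun z => fderiv ℝ g z w) z := by
  obtain ⟨k, hk, hgk⟩ := exists_compact_slices hc
  have hsw : ContDiff ℝ ∞ (fun q : ℝ × ℝ => g (q.2, q.1)) :=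
    hg.comp (contDiff_snd.prodMk contDiff_fst)
  have h := hasFDerivAt_convolution_right_with_param (μ := volume) (s := Set.univ)
    (ContinuousLinearMap.lsmul ℝ ℝ) (g := fun p x => g (x, p)) isOpen_univ hk
    (fun p x _ => hgk p x) hf (hsw.of_le (by simp)).contDiffOn (z.2, z.1) trivial
  have hcs : HasCompactSupport (fun q : ℝ × ℝ => g (q.2, q.1)) :=
    hc.comp_homeomorph (Homeomorph.prodComm ℝ ℝ)
  have h2 := h.comp z (f := fun z : ℝ × ℝ => (z.2, z.1))
    (hasFDerivAt_snd.prodMk hasFDerivAt_fst)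
  rw [convFst_eq_convolution]
  erw [h2.fderiv]
  have hcont : Continuous (fun x : ℝ => fderiv ℝ (fun q : ℝ × ℝ => g (q.2, q.1)) (z.2, x)) :=
    (hsw.continuous_fderiv (by simp)).comp (by fun_prop)
  have hcs' : HasCompactSupport
      (fun x : ℝ => fderiv ℝ (fun q : ℝ × ℝ => g (q.2, q.1)) (z.2, x)) := by
    refine HasCompactSupport.intro ((hcs.fderiv (𝕜 := ℝ)).isCompact.image continuous_snd)
      fun x hx => ?_
    by_contra hne
    exact hx ⟨(z.2, x), subset_tsupport _ hne, rfl⟩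
  erw [convolution_precompR_apply (ContinuousLinearMap.lsmul ℝ ℝ) hf hcs' hcont]
  simp only [convFst, convolution_eq_swap, ContinuousLinearMap.lsmul_apply, smul_eq_mul]
  congr 1
  funext x
  have h3 := ((hg.differentiable (by simp) (x, z.2)).hasFDerivAt.comp (z.2, x)
    (f := fun q : ℝ × ℝ => (q.2, q.1)) (hasFDerivAt_snd.prodMk hasFDerivAt_fst)).fderiv
  have h4 : fderiv ℝ (fun q : ℝ × ℝ => g (q.2, q.1)) (z.2, x) (w.2, w.1)
      = fderiv ℝ g (x, z.2) w := by
    erw [h3]; rfl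
  exact congrArg _ h4

/-! ### The integration kernel with averaged base point -/

/-- A smooth function equal to `1` on `(-∞, 0]` and to `0` on `[1, ∞)`. -/
noncomputable def step (s : ℝ) : ℝ := Real.smoothTransition (1 - s)

theorem contDiff_step : ContDiff ℝ ∞ step :=
  Real.smoothTransition.contDiff.comp (contDiff_const.sub contDiff_id)

theorem step_of_nonpos {s : ℝ} (h : s ≤ 0) : step s = 1 :=
  Real.smoothTransition.one_of_one_le (by linarith)

theorem step_of_one_le {s : ℝ} (h : 1 ≤ s) : step s = 0 :=
  Real.smoothTransition.zero_of_nonpos (by linarith)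

theorem deriv_step_of_notMem {s : ℝ} (h : s ∉ Set.Icc (0 : ℝ) 1) : deriv step s = 0 := by
  rw [Set.mem_Icc, not_and_or, not_le, not_le] at h
  rcases h with h | h
  · have : step =ᶠ[𝓝 s] fun _ => 1 := by
      filter_upwards [Iio_mem_nhds h] with x hx using step_of_nonpos (le_of_lt hx)
    rw [this.deriv_eq, deriv_const]
  · have : step =ᶠ[𝓝 s] fun _ => 0 := by
      filter_upwards [Ioi_mem_nhds h] with x hx using step_of_one_le (le_of_lt hx)
    rw [this.deriv_eq, deriv_const]

theorem continuous_deriv_step : Continuous (deriv step) :=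
  contDiff_step.continuous_deriv (by simp)

theorem exists_bound_deriv_step : ∃ A : ℝ≥0, ∀ s, ‖deriv step s‖ ≤ A := by
  have hc : HasCompactSupport (deriv step) :=
    HasCompactSupport.intro isCompact_Icc fun _ => deriv_step_of_notMem
  obtain ⟨A, hA⟩ := hc.exists_bound_of_continuous continuous_deriv_step
  exact ⟨⟨max A 0, le_max_right _ _⟩, fun s => (hA s).trans (le_max_left _ _)⟩

/-- The kernel of a smoothed antiderivative: `∂ₓ ∫ ker x s f(s) ds = f(x)`. -/
noncomputable def ker (x s : ℝ) : ℝ := (Set.Iio (0 : ℝ)).indicator 1 (s - x) - step s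

theorem ker_eq (x s : ℝ) : ker x s = (if s < x then 1 else 0) - step s := by
  simp [ker, Set.indicator_apply]

theorem measurable_ker : Measurable (Function.uncurry ker) := by
  refine Measurable.sub ?_ (contDiff_step.continuous.measurable.comp measurable_snd)
  exact (measurable_one.indicator measurableSet_Iio).comp (measurable_snd.sub measurable_fst)

theorem norm_ker_le (x s : ℝ) : ‖ker x s‖ ≤ 1 := by
  have h0 : 0 ≤ step s := Real.smoothTransition.nonneg _
  have h1 : step s ≤ 1 := Real.smoothTransition.le_one _
  rw [ker_eq, Real.norm_eq_abs, abs_le]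
  split_ifs <;> constructor <;> linarith

/-- To the left of `-n` both terms are 1 and to the right of `n` both are 0; `1 ≤ n` puts the
transition interval of `step` inside `[-n, n]`. This confines every later integral to a bounded
square. -/
theorem ker_eq_zero {n x s : ℝ} (hn : 1 ≤ n) (hx : x ∈ Set.Icc (-n) n)
    (hs : s ∉ Set.Icc (-n) n) : ker x s = 0 := by
  rw [Set.mem_Icc, not_and_or, not_le, not_le] at hs
  rw [ker_eq]
  rcases hs with h | h
  · rw [if_pos (by linarith [hx.1]), step_of_nonpos (by linarith), sub_self]
  · rw [if_neg (by linarith [hx.2]), step_of_one_le (by linarith), sub_self]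

theorem integral_deriv_of_hasCompactSupport {h : ℝ → ℝ} (hh : ContDiff ℝ 1 h)
    (hc : HasCompactSupport h) : ∫ x, deriv h x = 0 := by
  have hi : Integrable (deriv h) :=
    (hh.continuous_deriv le_rfl).integrable_of_hasCompactSupport hc.deriv
  rw [← intervalIntegral.integral_Iic_add_Ioi (b := 0) hi.integrableOn hi.integrableOn,
    hc.integral_Iic_deriv_eq hh, hc.integral_Ioi_deriv_eq hh]
  ring

theorem integral_ker_mul {h : ℝ → ℝ} (hi : Integrable h) (s : ℝ) :
    ∫ x, ker x s * h x = (∫ x in Set.Ioi s, h x) - step s * ∫ x, h x := by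
  rw [← integral_const_mul, ← integral_indicator measurableSet_Ioi, ← integral_sub
    (hi.indicator measurableSet_Ioi) (hi.const_mul _)]
  congr 1
  funext x
  rw [ker_eq, Set.indicator_apply]
  simp only [Set.mem_Ioi]
  split_ifs <;> ring

/-- The `step` part of the kernel is independent of `x` and drops out because a compactly supported
derivative has integral zero. -/
theorem integral_ker_mul_deriv {h : ℝ → ℝ} (hh : ContDiff ℝ 1 h) (hc : HasCompactSupport h)
    (s : ℝ) : ∫ x, ker x s * deriv h x = -h s := by
  have hi : Integrable (deriv h) :=
    (hh.continuous_deriv le_rfl).integrable_of_hasCompactSupport hc.deriv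
  rw [integral_ker_mul hi, hc.integral_Ioi_deriv_eq hh, integral_deriv_of_hasCompactSupport hh hc]
  ring

theorem locallyIntegrable_indicator_Iio :
    LocallyIntegrable ((Set.Iio (0 : ℝ)).indicator (1 : ℝ → ℝ)) :=
  (locallyIntegrable_const (1 : ℝ)).indicator measurableSet_Iio

/-! ### The transposed antiderivative on test functions -/

/-- The integral of `g` over horizontal lines. -/
noncomputable def lineIntegral (g : ℝ × ℝ → ℝ) (y : ℝ) : ℝ := ∫ x, g (x, y)

/-- The transpose of the smoothed antiderivative in the first variable. -/
noncomputable def dualPrim (g : ℝ × ℝ → ℝ) (z : ℝ × ℝ) : ℝ := ∫ x, ker x z.1 * g (x, z.2)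

section Slices

variable {g : ℝ × ℝ → ℝ}

theorem hasCompactSupport_slice (hc : HasCompactSupport g) (y : ℝ) :
    HasCompactSupport fun x => g (x, y) := by
  obtain ⟨k, hk, hgk⟩ := exists_compact_slices hc
  exact HasCompactSupport.intro hk (hgk y)

theorem integrable_slice (hg : Continuous g) (hc : HasCompactSupport g) (y : ℝ) :
    Integrable fun x => g (x, y) :=
  (hg.comp (by fun_prop)).integrable_of_hasCompactSupport (hasCompactSupport_slice hc y)

theorem convFst_one (g : ℝ × ℝ → ℝ) (z : ℝ × ℝ) : convFst (fun _ => 1) g z = lineIntegral g z.2 := by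
  simp [convFst, lineIntegral]

/-- Separates the jump of the kernel, handled as a convolution, from a product of smooth functions;
smoothness and derivatives of `dualPrim` are read off from this form. -/
theorem dualPrim_eq (hg : Continuous g) (hc : HasCompactSupport g) (z : ℝ × ℝ) :
    dualPrim g z = convFst ((Set.Iio (0 : ℝ)).indicator 1) g z - step z.1 * lineIntegral g z.2 := by
  have hi := integrable_slice hg hc z.2
  rw [dualPrim, lineIntegral, integral_ker_mul hi, convFst, ← integral_indicator measurableSet_Ioi]
  congr 2
  funext x
  simp [Set.indicator_apply]

theorem contDiff_lineIntegral (hg : ContDiff ℝ ∞ g) (hc : HasCompactSupport g) :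
    ContDiff ℝ ∞ (lineIntegral g) := by
  have h := (contDiff_convFst (locallyIntegrable_const (1 : ℝ)) hg hc).comp
    (contDiff_const.prodMk contDiff_id : ContDiff ℝ ∞ fun y : ℝ => ((0 : ℝ), y))
  convert! h using 1
  funext y
  exact (convFst_one g (0, y)).symm

theorem deriv_lineIntegral (hg : ContDiff ℝ ∞ g) (hc : HasCompactSupport g) (y : ℝ) :
    deriv (lineIntegral g) y = lineIntegral (fun z => fderiv ℝ g z (0, 1)) y := by
  have h := fderiv_convFst (locallyIntegrable_const (1 : ℝ)) hg hc (0, y) (0, 1)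
  rw [convFst_one] at h
  rw [← h, funext (convFst_one g)]
  have h2 := ((contDiff_lineIntegral hg hc).differentiable (by simp) y).hasDerivAt
  have h3 := h2.hasFDerivAt.comp ((0 : ℝ), y) (f := Prod.snd) hasFDerivAt_snd
  erw [h3.fderiv]
  simp

theorem hasCompactSupport_lineIntegral (hc : HasCompactSupport g) :
    HasCompactSupport (lineIntegral g) := by
  refine HasCompactSupport.intro (hc.isCompact.image continuous_snd) fun y hy => ?_
  rw [lineIntegral]
  refine integral_eq_zero_of_ae (Eventually.of_forall fun x => ?_)
  by_contra h
  exact hy ⟨(x, y), subset_tsupport g h, rfl⟩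

theorem contDiff_dualPrim (hg : ContDiff ℝ ∞ g) (hc : HasCompactSupport g) :
    ContDiff ℝ ∞ (dualPrim g) := by
  rw [funext (dualPrim_eq hg.continuous hc)]
  exact (contDiff_convFst locallyIntegrable_indicator_Iio hg hc).sub
    ((contDiff_step.comp contDiff_fst).mul ((contDiff_lineIntegral hg hc).comp contDiff_snd))

theorem exists_square (hc : HasCompactSupport g) :
    ∃ n : ℕ, 1 ≤ n ∧ ∀ z, z ∉ Set.Icc (-(n : ℝ)) n ×ˢ Set.Icc (-(n : ℝ)) n → g z = 0 := by
  obtain ⟨r, hr⟩ := hc.isCompact.isBounded.subset_closedBall 0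
  obtain ⟨n, hn⟩ := exists_nat_ge r
  refine ⟨n + 1, by simp, fun z hz => ?_⟩
  by_contra h
  have h1 := hr (subset_tsupport g h)
  rw [mem_closedBall_zero_iff, Prod.norm_def, max_le_iff, Real.norm_eq_abs, Real.norm_eq_abs,
    abs_le, abs_le] at h1
  refine hz ⟨⟨?_, ?_⟩, ?_, ?_⟩ <;> push_cast <;> linarith [h1.1.1, h1.1.2, h1.2.1, h1.2.2]

theorem dualPrim_eq_zero {n : ℝ} (hn : 1 ≤ n)
    (h : ∀ z, z ∉ Set.Icc (-n) n ×ˢ Set.Icc (-n) n → g z = 0) {z : ℝ × ℝ}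
    (hz : z ∉ Set.Icc (-n) n ×ˢ Set.Icc (-n) n) : dualPrim g z = 0 := by
  refine integral_eq_zero_of_ae (Eventually.of_forall fun x => ?_)
  by_cases hx : (x, z.2) ∈ Set.Icc (-n) n ×ˢ Set.Icc (-n) n
  · have : z.1 ∉ Set.Icc (-n) n := fun h1 => hz ⟨h1, hx.2⟩
    simp [ker_eq_zero hn hx.1 this]
  · simp [h _ hx]

/-- Without the `step` correction the integral over `x > s` would tend to the full line integral of
`g` as `s → -∞`; the correction cancels it there. Thus `dualPrim g` is an admissible test function.
-/
theorem hasCompactSupport_dualPrim (hc : HasCompactSupport g) :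
    HasCompactSupport (dualPrim g) := by
  obtain ⟨n, hn, h⟩ := exists_square hc
  exact HasCompactSupport.intro (isCompact_Icc.prod isCompact_Icc)
    fun z hz => dualPrim_eq_zero (by exact_mod_cast hn) h hz

theorem contDiff_fderiv_apply_const (hg : ContDiff ℝ ∞ g) (w : ℝ × ℝ) :
    ContDiff ℝ ∞ fun z => fderiv ℝ g z w :=
  (hg.fderiv_right (by simp)).clm_apply contDiff_const

theorem hasCompactSupport_fderiv_apply_const (hc : HasCompactSupport g) (w : ℝ × ℝ) :
    HasCompactSupport fun z => fderiv ℝ g z w :=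
  (hc.fderiv (𝕜 := ℝ)).comp_left (g := fun L : ℝ × ℝ →L[ℝ] ℝ => L w) rfl

theorem fderiv_step_fst_mul_lineIntegral (hg : ContDiff ℝ ∞ g) (hc : HasCompactSupport g)
    (z w : ℝ × ℝ) :
    fderiv ℝ (fun z : ℝ × ℝ => step z.1 * lineIntegral g z.2) z w =
      step z.1 * (deriv (lineIntegral g) z.2 * w.2) + lineIntegral g z.2 * (deriv step z.1 * w.1) := by
  have h1 := (contDiff_step.differentiable (by simp) z.1).hasDerivAt.hasFDerivAt.comp z
    (f := Prod.fst) hasFDerivAt_fst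
  have h2 := ((contDiff_lineIntegral hg hc).differentiable (by simp) z.2).hasDerivAt.hasFDerivAt.comp
    z (f := Prod.snd) hasFDerivAt_snd
  have h3 := h1.mul h2
  erw [h3.fderiv]
  simp
  ring

theorem fderiv_dualPrim (hg : ContDiff ℝ ∞ g) (hc : HasCompactSupport g) (z w : ℝ × ℝ) :
    fderiv ℝ (dualPrim g) z w =
      convFst ((Set.Iio (0 : ℝ)).indicator 1) (fun z => fderiv ℝ g z w) z -
      (step z.1 * (deriv (lineIntegral g) z.2 * w.2) +
        lineIntegral g z.2 * (deriv step z.1 * w.1)) := by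
  rw [funext (dualPrim_eq hg.continuous hc), fderiv_fun_sub, sub_apply,
    fderiv_convFst locallyIntegrable_indicator_Iio hg hc,
    fderiv_step_fst_mul_lineIntegral hg hc]
  · exact (contDiff_convFst locallyIntegrable_indicator_Iio hg hc).differentiable (by simp) z
  · exact ((contDiff_step.comp contDiff_fst).mul
      ((contDiff_lineIntegral hg hc).comp contDiff_snd)).differentiable (by simp) z

theorem deriv_slice (hg : ContDiff ℝ ∞ g) (x y : ℝ) :
    deriv (fun x => g (x, y)) x = fderiv ℝ g (x, y) (1, 0) :=
  ((hg.differentiable (by simp) (x, y)).hasFDerivAt.comp_hasDerivAt x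
    ((hasDerivAt_id x).prodMk (hasDerivAt_const x y))).deriv

theorem contDiff_slice (hg : ContDiff ℝ ∞ g) (y : ℝ) : ContDiff ℝ 1 fun x => g (x, y) :=
  (hg.of_le (by simp)).comp (contDiff_id.prodMk contDiff_const)

theorem lineIntegral_fderiv_fst (hg : ContDiff ℝ ∞ g) (hc : HasCompactSupport g) (y : ℝ) :
    lineIntegral (fun z => fderiv ℝ g z (1, 0)) y = 0 := by
  have h := integral_deriv_of_hasCompactSupport (contDiff_slice hg y) (hasCompactSupport_slice hc y)
  simp only [deriv_slice hg] at h
  exact h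

theorem dualPrim_fderiv_fst (hg : ContDiff ℝ ∞ g) (hc : HasCompactSupport g) (z : ℝ × ℝ) :
    dualPrim (fun z => fderiv ℝ g z (1, 0)) z = -g z := by
  have h := integral_ker_mul_deriv (contDiff_slice hg z.2) (hasCompactSupport_slice hc z.2) z.1
  simp only [deriv_slice hg] at h
  exact h

/-- The term with `deriv step` is the price of compact support; `primSnd` is designed to compensate
for it. -/
theorem fderiv_dualPrim_fst (hg : ContDiff ℝ ∞ g) (hc : HasCompactSupport g) (z : ℝ × ℝ) :
    fderiv ℝ (dualPrim g) z (1, 0) = -g z - deriv step z.1 * lineIntegral g z.2 := by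
  rw [fderiv_dualPrim hg hc, ← dualPrim_fderiv_fst hg hc z,
    dualPrim_eq (contDiff_fderiv_apply_const hg _).continuous
      (hasCompactSupport_fderiv_apply_const hc _), lineIntegral_fderiv_fst hg hc]
  ring

theorem fderiv_dualPrim_snd (hg : ContDiff ℝ ∞ g) (hc : HasCompactSupport g) (z : ℝ × ℝ) :
    fderiv ℝ (dualPrim g) z (0, 1) = dualPrim (fun z => fderiv ℝ g z (0, 1)) z := by
  rw [fderiv_dualPrim hg hc, deriv_lineIntegral hg hc,
    dualPrim_eq (contDiff_fderiv_apply_const hg _).continuous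
      (hasCompactSupport_fderiv_apply_const hc _)]
  ring

end Slices


/-! ### The stream function and its weak derivatives -/

/-- The square `[-r, r]²`. -/
def square (r : ℝ) : Set (ℝ × ℝ) := Set.Icc (-r) r ×ˢ Set.Icc (-r) r

theorem measurableSet_square (r : ℝ) : MeasurableSet (square r) :=
  measurableSet_Icc.prod measurableSet_Icc

theorem isCompact_square (r : ℝ) : IsCompact (square r) := isCompact_Icc.prod isCompact_Icc

theorem integrable_mul_of_eq_zero {v h : ℝ × ℝ → ℝ} {r C : ℝ} (hv : IntegrableOn v (square r))
    (hh : Measurable h) (hC : ∀ z, ‖h z‖ ≤ C) (h0 : ∀ z ∉ square r, h z = 0) :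
    Integrable fun z => v z * h z := by
  have h1 : IntegrableOn (fun z => v z * h z) (square r) :=
    Integrable.mul_bdd (c := C) hv hh.aestronglyMeasurable (Eventually.of_forall hC)
  rw [← integrable_indicator_iff (measurableSet_square r)] at h1
  refine h1.congr (Eventually.of_forall fun z => ?_)
  by_cases hz : z ∈ square r <;> simp [hz, h0]

/-- The smoothed antiderivative of `v` in the first variable. -/
noncomputable def primFst (v : ℝ × ℝ → ℝ) (z : ℝ × ℝ) : ℝ := ∫ s, ker z.1 s * v (s, z.2)

/-- The smoothed antiderivative of the average of `v` over the strip `0 ≤ s ≤ 1`. -/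
noncomputable def primSnd (v : ℝ × ℝ → ℝ) (y : ℝ) : ℝ :=
  ∫ p : ℝ × ℝ, ker y p.2 * (deriv step p.1 * v p)

/-- The stream function of `(v₁, v₂)`: `∂ₓ ψ = v₂` and `∂ᵧ ψ = -v₁`. -/
noncomputable def stream (v₁ v₂ : ℝ × ℝ → ℝ) (z : ℝ × ℝ) : ℝ := primFst v₂ z + primSnd v₁ z.2

section

variable {v : ℝ × ℝ → ℝ}

theorem measurable_primFst (hv : Measurable v) : Measurable (primFst v) := by
  have : StronglyMeasurable fun p : (ℝ × ℝ) × ℝ => ker p.1.1 p.2 * v (p.2, p.1.2) := by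
    refine (Measurable.mul ?_ ?_).stronglyMeasurable
    · exact measurable_ker.comp ((measurable_fst.comp measurable_fst).prodMk measurable_snd)
    · exact hv.comp (measurable_snd.prodMk (measurable_snd.comp measurable_fst))
  exact this.integral_prod_right.measurable

theorem measurable_primSnd (hv : Measurable v) : Measurable (primSnd v) := by
  have : StronglyMeasurable fun p : ℝ × (ℝ × ℝ) => ker p.1 p.2.2 * (deriv step p.2.1 * v p.2) := by
    refine (Measurable.mul ?_ (Measurable.mul ?_ ?_)).stronglyMeasurable
    · exact measurable_ker.comp (measurable_fst.prodMk (measurable_snd.comp measurable_snd))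
    · exact continuous_deriv_step.measurable.comp (measurable_fst.comp measurable_snd)
    · exact hv.comp measurable_snd
  exact this.integral_prod_right.measurable

theorem measurable_stream {v₁ v₂ : ℝ × ℝ → ℝ} (h₁ : Measurable v₁) (h₂ : Measurable v₂) :
    Measurable (stream v₁ v₂) :=
  (measurable_primFst h₂).add ((measurable_primSnd h₁).comp measurable_snd)

/-- The rearrangement `((x, y), s) ↦ (x, (s, y))`. -/
def rotateEquiv : (ℝ × ℝ) × ℝ ≃ᵐ ℝ × (ℝ × ℝ) :=
  MeasurableEquiv.prodAssoc.trans ((MeasurableEquiv.refl ℝ).prodCongr MeasurableEquiv.prodComm)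

theorem measurePreserving_rotateEquiv :
    MeasurePreserving rotateEquiv (volume : Measure ((ℝ × ℝ) × ℝ)) volume :=
  (MeasurePreserving.prod (MeasurePreserving.id volume) Measure.measurePreserving_swap).comp
    (volume_preserving_prodAssoc)

/-- Justifies Fubini: the integrand is dominated by a product of a function of `x` and a function of
`(s, y)`, since `ker` vanishes for `s` outside `[-r, r]`. -/
theorem integrable_primFst_aux {h : ℝ × ℝ → ℝ} {r C : ℝ} (hr : 1 ≤ r) (hvm : Measurable v)
    (hv : IntegrableOn v (square r)) (hh : Measurable h) (hC : ∀ z, ‖h z‖ ≤ C)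
    (h0 : ∀ z ∉ square r, h z = 0) :
    Integrable fun p : ℝ × (ℝ × ℝ) => ker p.1 p.2.1 * v p.2 * h (p.1, p.2.2) := by
  have h1 : Integrable ((Set.Icc (-r) r).indicator fun _ : ℝ => C) :=
    (integrable_indicator_iff measurableSet_Icc).2 (integrableOn_const (by simp))
  have h2 : Integrable ((square r).indicator v) :=
    (integrable_indicator_iff (measurableSet_square r)).2 hv
  refine (h1.mul_prod h2).mono ?_ (Eventually.of_forall ?_)
  · refine (Measurable.mul (Measurable.mul ?_ ?_) ?_).aestronglyMeasurable
    · exact measurable_ker.comp (measurable_fst.prodMk (measurable_fst.comp measurable_snd))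
    · exact hvm.comp measurable_snd
    · exact hh.comp (measurable_fst.prodMk (measurable_snd.comp measurable_snd))
  · rintro ⟨x, s, y⟩
    by_cases hxy : (x, y) ∈ square r
    · by_cases hs : s ∈ Set.Icc (-r) r
      · have hsy : (s, y) ∈ square r := ⟨hs, hxy.2⟩
        have hx : x ∈ Set.Icc (-r) r := hxy.1
        have hC0 : 0 ≤ C := (norm_nonneg _).trans (hC (x, y))
        simp only [Set.indicator_of_mem hx, Set.indicator_of_mem hsy, norm_mul]
        rw [Real.norm_of_nonneg hC0]
        calc ‖ker x s‖ * ‖v (s, y)‖ * ‖h (x, y)‖ ≤ 1 * ‖v (s, y)‖ * C := by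
              gcongr
              · exact norm_ker_le x s
              · exact hC _
          _ = C * ‖v (s, y)‖ := by ring
      · simp only [ker_eq_zero hr hxy.1 hs, zero_mul, norm_zero]
        positivity
    · simp only [h0 _ hxy, mul_zero, norm_zero]
      positivity

theorem integral_primFst_mul {h : ℝ × ℝ → ℝ} {r C : ℝ} (hr : 1 ≤ r) (hvm : Measurable v)
    (hv : IntegrableOn v (square r)) (hh : Measurable h) (hC : ∀ z, ‖h z‖ ≤ C)
    (h0 : ∀ z ∉ square r, h z = 0) :
    Integrable (fun z => primFst v z * h z) ∧
      ∫ z, primFst v z * h z = ∫ z, v z * dualPrim h z := by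
  have hi := integrable_primFst_aux hr hvm hv hh hC h0
  have hi' : Integrable fun p : (ℝ × ℝ) × ℝ => ker p.1.1 p.2 * v (p.2, p.1.2) * h p.1 :=
    (measurePreserving_rotateEquiv.integrable_comp_emb rotateEquiv.measurableEmbedding).2 hi
  have he : ∀ z : ℝ × ℝ, ∫ s, ker z.1 s * v (s, z.2) * h z = primFst v z * h z := fun z => by
    rw [integral_mul_const, primFst]
  constructor
  · have := hi'.integral_prod_left
    simpa only [he] using this
  · have h1 := integral_prod _ hi'
    simp only [he] at h1
    have h2 := integral_prod_symm _ hi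
    have h3 : ∀ z : ℝ × ℝ, ∫ x, ker x z.1 * v z * h (x, z.2) = v z * dualPrim h z := fun z => by
      rw [dualPrim, ← integral_const_mul]
      congr 1
      funext x
      ring
    simp only [h3] at h2
    calc ∫ z, primFst v z * h z = _ := h1.symm
      _ = _ := measurePreserving_rotateEquiv.integral_comp' (g := fun p : ℝ × (ℝ × ℝ) =>
        ker p.1 p.2.1 * v p.2 * h (p.1, p.2.2))
      _ = _ := h2

theorem integral_primSnd_mul {h : ℝ × ℝ → ℝ} {r C : ℝ} (hr : 1 ≤ r) (hvm : Measurable v)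
    (hv : IntegrableOn v (square r)) (hh : Measurable h) (hC : ∀ z, ‖h z‖ ≤ C)
    (h0 : ∀ z ∉ square r, h z = 0) :
    Integrable (fun z : ℝ × ℝ => primSnd v z.2 * h z) ∧
      ∫ z : ℝ × ℝ, primSnd v z.2 * h z =
        ∫ p : ℝ × ℝ, v p * (deriv step p.1 * ∫ z : ℝ × ℝ, ker z.2 p.2 * h z) := by
  obtain ⟨A, hA⟩ := exists_bound_deriv_step
  have h1 : Integrable ((square r).indicator fun _ : ℝ × ℝ => C) :=
    (integrable_indicator_iff (measurableSet_square r)).2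
      (integrableOn_const (isCompact_square r).measure_ne_top)
  have h2 : Integrable ((square r).indicator v) :=
    (integrable_indicator_iff (measurableSet_square r)).2 hv
  have hi : Integrable fun q : (ℝ × ℝ) × (ℝ × ℝ) =>
      ker q.1.2 q.2.2 * (deriv step q.2.1 * v q.2) * h q.1 := by
    refine ((h1.mul_prod h2).const_mul (A : ℝ)).mono ?_ (Eventually.of_forall ?_)
    · refine (Measurable.mul (Measurable.mul ?_ (Measurable.mul ?_ ?_)) ?_).aestronglyMeasurable
      · exact measurable_ker.comp
          ((measurable_snd.comp measurable_fst).prodMk (measurable_snd.comp measurable_snd))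
      · exact continuous_deriv_step.measurable.comp (measurable_fst.comp measurable_snd)
      · exact hvm.comp measurable_snd
      · exact hh.comp measurable_fst
    · rintro ⟨⟨x, y⟩, s, t⟩
      by_cases hxy : (x, y) ∈ square r
      · by_cases hst : (s, t) ∈ square r
        · have hC0 : 0 ≤ C := (norm_nonneg _).trans (hC (x, y))
          simp only [Set.indicator_of_mem hxy, Set.indicator_of_mem hst, norm_mul]
          rw [Real.norm_of_nonneg hC0, Real.norm_of_nonneg (NNReal.coe_nonneg A)]
          calc ‖ker y t‖ * (‖deriv step s‖ * ‖v (s, t)‖) * ‖h (x, y)‖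
              ≤ 1 * (A * ‖v (s, t)‖) * C := by
                gcongr
                · exact norm_ker_le y t
                · exact hA s
                · exact hC _
            _ = A * (C * ‖v (s, t)‖) := by ring
        · have : ker y t * deriv step s = 0 := by
            by_cases ht : t ∈ Set.Icc (-r) r
            · rw [deriv_step_of_notMem, mul_zero]
              exact fun hs => hst ⟨⟨by linarith [hs.1], by linarith [hs.2]⟩, ht⟩
            · rw [ker_eq_zero hr hxy.2 ht, zero_mul]
          simp only [← mul_assoc, this, zero_mul, norm_zero]
          positivity
      · simp only [h0 _ hxy, mul_zero, norm_zero]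
        positivity
  have he : ∀ z : ℝ × ℝ, ∫ p : ℝ × ℝ, ker z.2 p.2 * (deriv step p.1 * v p) * h z =
      primSnd v z.2 * h z := fun z => by
    rw [integral_mul_const, primSnd]
  constructor
  · have := hi.integral_prod_left
    simpa only [he] using this
  · have h3 := integral_integral_swap (f := fun z p : ℝ × ℝ =>
      ker z.2 p.2 * (deriv step p.1 * v p) * h z) hi
    simp only [he] at h3
    rw [h3]
    congr 1
    funext p
    rw [← mul_assoc, ← integral_const_mul]
    congr 1
    funext z
    ring

end

theorem integrable_mul_of_hasCompactSupport {v h : ℝ × ℝ → ℝ}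
    (hi : ∀ n : ℕ, IntegrableOn v (square n)) (hh : Continuous h) (hc : HasCompactSupport h) :
    Integrable fun z => v z * h z := by
  obtain ⟨n, -, hn⟩ := exists_square hc
  obtain ⟨C, hC⟩ := hc.exists_bound_of_continuous hh
  exact integrable_mul_of_eq_zero (hi n) hh.measurable hC hn

theorem integral_stream_mul {v₁ v₂ : ℝ × ℝ → ℝ} (hm₁ : Measurable v₁) (hm₂ : Measurable v₂)
    (hi₁ : ∀ n : ℕ, IntegrableOn v₁ (square n)) (hi₂ : ∀ n : ℕ, IntegrableOn v₂ (square n))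
    {h : ℝ × ℝ → ℝ} (hh : Continuous h) (hc : HasCompactSupport h) :
    Integrable (fun z => stream v₁ v₂ z * h z) ∧
    ∫ z, stream v₁ v₂ z * h z = (∫ z, v₂ z * dualPrim h z) +
      ∫ p : ℝ × ℝ, v₁ p * (deriv step p.1 * ∫ y, ker y p.2 * lineIntegral h y) := by
  obtain ⟨n, hn, h0⟩ := exists_square hc
  obtain ⟨C, hC⟩ := hc.exists_bound_of_continuous hh
  have hn' : (1 : ℝ) ≤ n := by exact_mod_cast hn
  obtain ⟨a1, a2⟩ := integral_primFst_mul hn' hm₂ (hi₂ n) hh.measurable hC h0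
  obtain ⟨b1, b2⟩ := integral_primSnd_mul hn' hm₁ (hi₁ n) hh.measurable hC h0
  have key : ∀ t, ∫ z : ℝ × ℝ, ker z.2 t * h z = ∫ y, ker y t * lineIntegral h y := fun t => by
    have hi : Integrable fun z : ℝ × ℝ => ker z.2 t * h z :=
      (hh.integrable_of_hasCompactSupport hc).bdd_mul (c := 1)
        (measurable_ker.comp (measurable_snd.prodMk measurable_const)).aestronglyMeasurable
        (Eventually.of_forall fun z => norm_ker_le _ _)
    rw [Measure.volume_eq_prod, integral_prod_symm _ hi]
    simp only [integral_const_mul, lineIntegral]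
  simp only [key] at b2
  simp only [stream, add_mul]
  exact ⟨a1.add b1, by rw [integral_add a1 b1, a2, b2]⟩

/-- `∂ₓ ψ = v₂` in the sense of distributions. -/
theorem integral_stream_mul_fderiv_fst {v₁ v₂ : ℝ × ℝ → ℝ} (hm₁ : Measurable v₁)
    (hm₂ : Measurable v₂) (hi₁ : ∀ n : ℕ, IntegrableOn v₁ (square n))
    (hi₂ : ∀ n : ℕ, IntegrableOn v₂ (square n)) {g : ℝ × ℝ → ℝ} (hg : ContDiff ℝ ∞ g)
    (hc : HasCompactSupport g) :
    ∫ z, stream v₁ v₂ z * fderiv ℝ g z (1, 0) = -∫ z, v₂ z * g z := by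
  rw [(integral_stream_mul hm₁ hm₂ hi₁ hi₂ (contDiff_fderiv_apply_const hg _).continuous
    (hasCompactSupport_fderiv_apply_const hc _)).2]
  simp only [dualPrim_fderiv_fst hg hc, lineIntegral_fderiv_fst hg hc, mul_zero, integral_zero,
    add_zero, mul_neg, integral_neg]

/-- `∂ᵧ ψ = -v₁` in the sense of distributions. -/
theorem integral_stream_mul_fderiv_snd {v₁ v₂ : ℝ × ℝ → ℝ} (hm₁ : Measurable v₁)
    (hm₂ : Measurable v₂) (hi₁ : ∀ n : ℕ, IntegrableOn v₁ (square n))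
    (hi₂ : ∀ n : ℕ, IntegrableOn v₂ (square n))
    (hdiv : ∀ g : ℝ × ℝ → ℝ, ContDiff ℝ ∞ g → HasCompactSupport g →
      ∫ z, (v₁ z * fderiv ℝ g z (1, 0) + v₂ z * fderiv ℝ g z (0, 1)) = 0)
    {g : ℝ × ℝ → ℝ} (hg : ContDiff ℝ ∞ g) (hc : HasCompactSupport g) :
    ∫ z, stream v₁ v₂ z * fderiv ℝ g z (0, 1) = ∫ z, v₁ z * g z := by
  have hg' := contDiff_fderiv_apply_const hg (0, 1)
  have hc' := hasCompactSupport_fderiv_apply_const hc (0, 1)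
  rw [(integral_stream_mul hm₁ hm₂ hi₁ hi₂ hg'.continuous hc').2]
  have h1 : ∀ t, ∫ y, ker y t * lineIntegral (fun z => fderiv ℝ g z (0, 1)) y
      = -lineIntegral g t := fun t => by
    simp only [← deriv_lineIntegral hg hc]
    exact integral_ker_mul_deriv ((contDiff_lineIntegral hg hc).of_le (by simp))
      (hasCompactSupport_lineIntegral hc) t
  have hG := contDiff_dualPrim hg hc
  have hGc := hasCompactSupport_dualPrim hc
  -- The only use of the divergence condition, tested with `dualPrim g`: it turns the `v₂` integral
  -- into a `v₁` integral, where the `deriv step` terms cancel and `v₁ g` remains.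
  have h2 := hdiv _ hG hGc
  have k1 := integrable_mul_of_hasCompactSupport hi₁ (contDiff_fderiv_apply_const hG (1, 0)).continuous
    (hasCompactSupport_fderiv_apply_const hGc _)
  have k2 := integrable_mul_of_hasCompactSupport hi₂ (contDiff_fderiv_apply_const hG (0, 1)).continuous
    (hasCompactSupport_fderiv_apply_const hGc _)
  have k3 := integrable_mul_of_hasCompactSupport hi₁ hg.continuous hc
  rw [integral_add k1 k2] at h2
  simp only [fderiv_dualPrim_snd hg hc] at h2
  rw [eq_neg_of_add_eq_zero_right h2, ← integral_neg]
  simp only [h1]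
  simp only [fderiv_dualPrim_fst hg hc] at k1 ⊢
  have k4 : Integrable fun p : ℝ × ℝ => v₁ p * (deriv step p.1 * -lineIntegral g p.2) :=
    (k1.add k3).congr (Eventually.of_forall fun z => by simp only [Pi.add_apply]; ring)
  have k5 : Integrable fun z : ℝ × ℝ => -(v₁ z * (-g z - deriv step z.1 * lineIntegral g z.2)) :=
    k1.neg
  rw [← integral_add k5 k4]
  congr 1
  funext z
  ring


/-! ### Growth of the stream function from energies of unit squares -/

theorem ennreal_add_sq_le (a b : ℝ≥0∞) : (a + b) ^ 2 ≤ 2 * (a ^ 2 + b ^ 2) := by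
  induction a using ENNReal.recTopCoe with
  | top => simp
  | coe a =>
    induction b using ENNReal.recTopCoe with
    | top => simp
    | coe b => exact_mod_cast (add_sq_le : (a + b) ^ 2 ≤ 2 * (a ^ 2 + b ^ 2))

theorem sq_lintegral_le {α : Type*} [MeasurableSpace α] (μ : Measure α) {f : α → ℝ≥0∞}
    (hf : AEMeasurable f μ) : (∫⁻ a, f a ∂μ) ^ 2 ≤ μ Set.univ * ∫⁻ a, f a ^ 2 ∂μ := by
  have h := ENNReal.lintegral_mul_le_Lp_mul_Lq μ Real.HolderConjugate.two_two
    (f := fun _ => 1) (g := f) aemeasurable_const hf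
  simp only [Pi.mul_apply, one_mul, ENNReal.one_rpow, lintegral_one] at h
  have h2 := pow_le_pow_left' h 2
  rw [mul_pow, ← ENNReal.rpow_natCast, ← ENNReal.rpow_natCast, ← ENNReal.rpow_natCast,
    ← ENNReal.rpow_mul, ← ENNReal.rpow_mul] at h2
  norm_num at h2
  exact h2

/-- The closed unit square centred at `p`. -/
def cell (p : ℝ × ℝ) : Set (ℝ × ℝ) :=
  Set.Icc (p.1 - 1 / 2) (p.1 + 1 / 2) ×ˢ Set.Icc (p.2 - 1 / 2) (p.2 + 1 / 2)

theorem exists_mem_Icc_of_mem_Icc {n : ℕ} (hn : 1 ≤ n) {x : ℝ} (hx : x ∈ Set.Icc (-(n : ℝ)) n) :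
    ∃ k ∈ Finset.Ico (-(n : ℤ)) n,
      x ∈ Set.Icc ((k : ℝ) + 1 / 2 - 1 / 2) ((k : ℝ) + 1 / 2 + 1 / 2) := by
  by_cases h : x = n
  -- The right endpoint has floor `n`, outside the index range, and is assigned to the last closed
  -- cell.
  · refine ⟨n - 1, by simp; omega, ?_⟩
    push_cast
    constructor <;> linarith
  · refine ⟨⌊x⌋, ?_, ?_⟩
    · rw [Finset.mem_Ico, Int.le_floor, Int.floor_lt]
      push_cast
      exact ⟨hx.1, lt_of_le_of_ne hx.2 h⟩
    · constructor <;> linarith [Int.floor_le x, Int.lt_floor_add_one x]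

theorem lintegral_le_sum_of_subset {α ι : Type*} [MeasurableSpace α] {μ : Measure α}
    (f : α → ℝ≥0∞) (t : Finset ι) (S : ι → Set α) {s : Set α} (hs : ∀ x ∈ s, ∃ k ∈ t, x ∈ S k) :
    ∫⁻ x in s, f x ∂μ ≤ ∑ k ∈ t, ∫⁻ x in S k, f x ∂μ := by
  calc ∫⁻ x in s, f x ∂μ ≤ ∫⁻ x in ⋃ k : t, S k, f x ∂μ := by
        refine lintegral_mono_set fun x hx => ?_
        obtain ⟨k, hk, hxk⟩ := hs x hx
        exact Set.mem_iUnion.2 ⟨⟨k, hk⟩, hxk⟩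
    _ ≤ ∑' k : t, ∫⁻ x in S k, f x ∂μ := lintegral_iUnion_le _ _
    _ = _ := by rw [tsum_fintype, Finset.sum_coe_sort t fun k => ∫⁻ x in S k, f x ∂μ]

theorem lintegral_horizontal_strip_le {f L : ℝ × ℝ → ℝ≥0∞} (hL : ∀ p, ∫⁻ z in cell p, f z ≤ L p)
    {n : ℕ} (hn : 1 ≤ n) (c : ℝ) :
    ∫⁻ z in Set.Icc (-(n : ℝ)) n ×ˢ Set.Icc (c - 1 / 2) (c + 1 / 2), f z ≤
      ∑ k ∈ Finset.Ico (-(n : ℤ)) n, L ((k : ℝ) + 1 / 2, c) := by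
  refine (lintegral_le_sum_of_subset f _ (fun k : ℤ => cell ((k : ℝ) + 1 / 2, c)) ?_).trans
    (Finset.sum_le_sum fun k _ => hL _)
  intro z hz
  obtain ⟨k, hk, h⟩ := exists_mem_Icc_of_mem_Icc hn hz.1
  exact ⟨k, hk, h, hz.2⟩

theorem lintegral_vertical_strip_le {f L : ℝ × ℝ → ℝ≥0∞} (hL : ∀ p, ∫⁻ z in cell p, f z ≤ L p)
    {n : ℕ} (hn : 1 ≤ n) (c : ℝ) :
    ∫⁻ z in Set.Icc (c - 1 / 2) (c + 1 / 2) ×ˢ Set.Icc (-(n : ℝ)) n, f z ≤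
      ∑ k ∈ Finset.Ico (-(n : ℤ)) n, L (c, (k : ℝ) + 1 / 2) := by
  refine (lintegral_le_sum_of_subset f _ (fun k : ℤ => cell (c, (k : ℝ) + 1 / 2)) ?_).trans
    (Finset.sum_le_sum fun k _ => hL _)
  intro z hz
  obtain ⟨k, hk, h⟩ := exists_mem_Icc_of_mem_Icc hn hz.2
  exact ⟨k, hk, hz.1, h⟩

theorem enorm_ker_le (x s : ℝ) : ‖ker x s‖ₑ ≤ 1 := by
  have : ‖ker x s‖₊ ≤ 1 := norm_ker_le x s
  rw [enorm_eq_nnnorm]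
  exact_mod_cast this

theorem sq_enorm_primFst_le {v : ℝ × ℝ → ℝ} (hv : Measurable v) {n : ℕ} (hn : 1 ≤ n) {z : ℝ × ℝ}
    (hz : z.1 ∈ Set.Icc (-(n : ℝ)) n) :
    ‖primFst v z‖ₑ ^ 2 ≤ 2 * n * ∫⁻ s in Set.Icc (-(n : ℝ)) n, ‖v (s, z.2)‖ₑ ^ 2 := by
  have hn' : (1 : ℝ) ≤ n := by exact_mod_cast hn
  have hm : Measurable fun s => v (s, z.2) := hv.comp (measurable_id.prodMk measurable_const)
  have h1 : ‖primFst v z‖ₑ ≤ ∫⁻ s in Set.Icc (-(n : ℝ)) n, ‖v (s, z.2)‖ₑ := by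
    rw [← lintegral_indicator measurableSet_Icc]
    refine (enorm_integral_le_lintegral_enorm _).trans (lintegral_mono fun s => ?_)
    by_cases hs : s ∈ Set.Icc (-(n : ℝ)) n
    · rw [Set.indicator_of_mem hs, enorm_mul]
      exact mul_le_of_le_one_left' (enorm_ker_le _ _)
    · simp [ker_eq_zero hn' hz hs]
  refine (pow_le_pow_left' h1 2).trans ((sq_lintegral_le _ hm.enorm.aemeasurable).trans_eq ?_)
  congr 1
  rw [Measure.restrict_apply_univ, Real.volume_Icc, sub_neg_eq_add, ← two_mul,
    ENNReal.ofReal_mul (by norm_num)]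
  simp

theorem sq_enorm_primSnd_le {v : ℝ × ℝ → ℝ} (hv : Measurable v) {A : ℝ≥0}
    (hA : ∀ s, ‖deriv step s‖ ≤ A) {n : ℕ} (hn : 1 ≤ n) {y : ℝ} (hy : y ∈ Set.Icc (-(n : ℝ)) n) :
    ‖primSnd v y‖ₑ ^ 2 ≤ A ^ 2 * (2 * n *
      ∫⁻ p in Set.Icc (0 : ℝ) 1 ×ˢ Set.Icc (-(n : ℝ)) n, ‖v p‖ₑ ^ 2) := by
  have hn' : (1 : ℝ) ≤ n := by exact_mod_cast hn
  have h1 : ‖primSnd v y‖ₑ ≤ A * ∫⁻ p in Set.Icc (0 : ℝ) 1 ×ˢ Set.Icc (-(n : ℝ)) n, ‖v p‖ₑ := by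
    rw [← lintegral_const_mul _ hv.enorm,
      ← lintegral_indicator (measurableSet_Icc.prod measurableSet_Icc)]
    refine (enorm_integral_le_lintegral_enorm _).trans (lintegral_mono fun p => ?_)
    by_cases hp : p ∈ Set.Icc (0 : ℝ) 1 ×ˢ Set.Icc (-(n : ℝ)) n
    · rw [Set.indicator_of_mem hp, enorm_mul, enorm_mul]
      have h1 : ‖ker y p.2‖ₑ ≤ 1 := enorm_ker_le _ _
      have h2 : ‖deriv step p.1‖ₑ ≤ A := by
        have : ‖deriv step p.1‖₊ ≤ A := hA p.1
        exact_mod_cast this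
      calc _ ≤ 1 * (A * ‖v p‖ₑ) := by gcongr
        _ = _ := one_mul _
    · have : ker y p.2 * deriv step p.1 = 0 := by
        by_cases ht : p.2 ∈ Set.Icc (-(n : ℝ)) n
        · rw [deriv_step_of_notMem fun hs => hp ⟨hs, ht⟩, mul_zero]
        · rw [ker_eq_zero hn' hy ht, zero_mul]
      simp [← mul_assoc, this]
  refine (pow_le_pow_left' h1 2).trans ?_
  rw [mul_pow]
  gcongr
  refine (sq_lintegral_le _ hv.enorm.aemeasurable).trans_eq ?_
  congr 1
  rw [Measure.restrict_apply_univ, Measure.volume_eq_prod, Measure.prod_prod, Real.volume_Icc,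
    Real.volume_Icc, sub_neg_eq_add, ← two_mul, ENNReal.ofReal_mul (by norm_num)]
  simp

/-- The square of side length `2` centred at `p`. -/
def box (p : ℝ × ℝ) : Set (ℝ × ℝ) :=
  Set.Icc (p.1 - 1) (p.1 + 1) ×ˢ Set.Icc (p.2 - 1) (p.2 + 1)

theorem volume_box (p : ℝ × ℝ) : volume (box p) = 4 := by
  rw [box, Measure.volume_eq_prod, Measure.prod_prod, Real.volume_Icc, Real.volume_Icc]
  ring_nf
  rw [← ENNReal.ofReal_pow (by norm_num)]
  norm_num

theorem measurableSet_box (p : ℝ × ℝ) : MeasurableSet (box p) :=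
  measurableSet_Icc.prod measurableSet_Icc

/-- The Cauchy–Schwarz bound does not depend on `x`, so the box contributes its width 2; its height
2 is covered by two rows of unit cells. In total `2n · 2 · 2nB`. -/
theorem lintegral_box_primFst_le {v : ℝ × ℝ → ℝ} {L : ℝ × ℝ → ℝ≥0∞} (hv : Measurable v)
    (hL : ∀ p, ∫⁻ z in cell p, ‖v z‖ₑ ^ 2 ≤ L p) {n : ℕ} (hn : 1 ≤ n) {B : ℝ≥0∞}
    (hB : ∀ c, ∑ k ∈ Finset.Ico (-(n : ℤ)) n, L ((k : ℝ) + 1 / 2, c) ≤ n * B) {p : ℝ × ℝ}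
    (hp : |p.1| + 1 ≤ n) :
    ∫⁻ z in box p, ‖primFst v z‖ₑ ^ 2 ≤ 8 * n ^ 2 * B := by
  have hx : ∀ z ∈ box p, z.1 ∈ Set.Icc (-(n : ℝ)) n := fun z hz =>
    ⟨by linarith [hz.1.1, neg_abs_le p.1], by linarith [hz.1.2, le_abs_self p.1]⟩
  have hstrip : ∫⁻ z in Set.Icc (-(n : ℝ)) n ×ˢ Set.Icc (p.2 - 1) (p.2 + 1), ‖v z‖ₑ ^ 2
      ≤ n * B + n * B := by
    refine (lintegral_mono_set ?_).trans ((lintegral_union_le _ _ _).trans (add_le_add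
      ((lintegral_horizontal_strip_le hL hn (p.2 - 1 / 2)).trans (hB _))
      ((lintegral_horizontal_strip_le hL hn (p.2 + 1 / 2)).trans (hB _))))
    rintro ⟨x, y⟩ ⟨hx, hy⟩
    simp only [Set.mem_Icc] at hx hy
    rcases le_total y p.2 with h | h
    · exact Or.inl ⟨hx, by constructor <;> linarith⟩
    · exact Or.inr ⟨hx, by constructor <;> linarith⟩
  have hmeas : Measurable fun y => ∫⁻ s in Set.Icc (-(n : ℝ)) n, ‖v (s, y)‖ₑ ^ 2 :=
    (hv.enorm.pow_const 2).lintegral_prod_left'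
  have hmeas' : Measurable fun z : ℝ × ℝ =>
      ∫⁻ s in Set.Icc (-(n : ℝ)) n, ‖v (s, z.2)‖ₑ ^ 2 := hmeas.comp measurable_snd
  calc ∫⁻ z in box p, ‖primFst v z‖ₑ ^ 2
      ≤ ∫⁻ z in box p, 2 * n * ∫⁻ s in Set.Icc (-(n : ℝ)) n, ‖v (s, z.2)‖ₑ ^ 2 :=
        setLIntegral_mono' (measurableSet_box p) fun z hz => sq_enorm_primFst_le hv hn (hx z hz)
    _ = 2 * n * ∫⁻ y in Set.Icc (p.2 - 1) (p.2 + 1), 2 *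
          ∫⁻ s in Set.Icc (-(n : ℝ)) n, ‖v (s, y)‖ₑ ^ 2 := by
        rw [lintegral_const_mul _ hmeas', box, Measure.volume_eq_prod,
          ← Measure.prod_restrict, lintegral_prod_symm' _ hmeas']
        congr 1
        refine lintegral_congr fun y => ?_
        dsimp only
        rw [lintegral_const, Measure.restrict_apply_univ, Real.volume_Icc, mul_comm]
        congr 1
        ring_nf
        norm_num
    _ = 2 * n * (2 * ∫⁻ z in Set.Icc (-(n : ℝ)) n ×ˢ Set.Icc (p.2 - 1) (p.2 + 1), ‖v z‖ₑ ^ 2) := by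
        rw [lintegral_const_mul _ hmeas, Measure.volume_eq_prod, ← Measure.prod_restrict,
          lintegral_prod_symm' _ (hv.enorm.pow_const 2)]
    _ ≤ 2 * n * (2 * (n * B + n * B)) := by gcongr
    _ = 8 * n ^ 2 * B := by ring

/-- The weight `deriv step` lives on the strip `0 ≤ s ≤ 1`, a single column of unit cells centred at
abscissa `1/2`. The pointwise bound `A² · 2n · nB` is multiplied by the area 4 of the box. -/
theorem lintegral_box_primSnd_le {v : ℝ × ℝ → ℝ} {L : ℝ × ℝ → ℝ≥0∞} (hv : Measurable v)
    (hL : ∀ p, ∫⁻ z in cell p, ‖v z‖ₑ ^ 2 ≤ L p) {A : ℝ≥0} (hA : ∀ s, ‖deriv step s‖ ≤ A)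
    {n : ℕ} (hn : 1 ≤ n) {B : ℝ≥0∞}
    (hB : ∀ c, ∑ k ∈ Finset.Ico (-(n : ℤ)) n, L (c, (k : ℝ) + 1 / 2) ≤ n * B) {p : ℝ × ℝ}
    (hp : |p.2| + 1 ≤ n) :
    ∫⁻ z in box p, ‖primSnd v z.2‖ₑ ^ 2 ≤ 8 * A ^ 2 * n ^ 2 * B := by
  have hy : ∀ z ∈ box p, z.2 ∈ Set.Icc (-(n : ℝ)) n := fun z hz =>
    ⟨by linarith [hz.2.1, neg_abs_le p.2], by linarith [hz.2.2, le_abs_self p.2]⟩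
  have hstrip : ∫⁻ z in Set.Icc (0 : ℝ) 1 ×ˢ Set.Icc (-(n : ℝ)) n, ‖v z‖ₑ ^ 2 ≤ n * B := by
    have := (lintegral_vertical_strip_le hL hn (1 / 2)).trans (hB _)
    norm_num at this ⊢
    exact this
  calc ∫⁻ z in box p, ‖primSnd v z.2‖ₑ ^ 2 ≤ ∫⁻ z in box p, A ^ 2 * (2 * n * (n * B)) :=
        setLIntegral_mono' (measurableSet_box p) fun z hz =>
          (sq_enorm_primSnd_le hv hA hn (hy z hz)).trans (by gcongr)
    _ = 8 * A ^ 2 * n ^ 2 * B := by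
        rw [lintegral_const, Measure.restrict_apply_univ, volume_box]
        ring

theorem lintegral_box_stream_le {v₁ v₂ : ℝ × ℝ → ℝ} {L : ℝ × ℝ → ℝ≥0∞} (hm₁ : Measurable v₁)
    (hm₂ : Measurable v₂) (hL₁ : ∀ p, ∫⁻ z in cell p, ‖v₁ z‖ₑ ^ 2 ≤ L p)
    (hL₂ : ∀ p, ∫⁻ z in cell p, ‖v₂ z‖ₑ ^ 2 ≤ L p) {A : ℝ≥0} (hA : ∀ s, ‖deriv step s‖ ≤ A)
    {n : ℕ} (hn : 1 ≤ n) {B : ℝ≥0∞}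
    (hB₁ : ∀ c, ∑ k ∈ Finset.Ico (-(n : ℤ)) n, L (c, (k : ℝ) + 1 / 2) ≤ n * B)
    (hB₂ : ∀ c, ∑ k ∈ Finset.Ico (-(n : ℤ)) n, L ((k : ℝ) + 1 / 2, c) ≤ n * B) {p : ℝ × ℝ}
    (hp₁ : |p.1| + 1 ≤ n) (hp₂ : |p.2| + 1 ≤ n) :
    ∫⁻ z in box p, ‖stream v₁ v₂ z‖ₑ ^ 2 ≤ 16 * (1 + A ^ 2) * n ^ 2 * B := by
  calc ∫⁻ z in box p, ‖stream v₁ v₂ z‖ₑ ^ 2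
      ≤ ∫⁻ z in box p, 2 * (‖primFst v₂ z‖ₑ ^ 2 + ‖primSnd v₁ z.2‖ₑ ^ 2) :=
        lintegral_mono fun z => (pow_le_pow_left' (enorm_add_le _ _) 2).trans
          (ennreal_add_sq_le _ _)
    _ = 2 * ((∫⁻ z in box p, ‖primFst v₂ z‖ₑ ^ 2) + ∫⁻ z in box p, ‖primSnd v₁ z.2‖ₑ ^ 2) := by
        have h := (measurable_primFst hm₂).enorm.pow_const 2
        have h' : Measurable fun z : ℝ × ℝ => ‖primSnd v₁ z.2‖ₑ ^ 2 :=
          ((measurable_primSnd hm₁).comp measurable_snd).enorm.pow_const 2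
        rw [lintegral_const_mul (2 : ℝ≥0∞) (f := fun z => ‖primFst v₂ z‖ₑ ^ 2 + ‖primSnd v₁ z.2‖ₑ ^ 2)
          (h.add h'), lintegral_add_left h]
    _ ≤ 2 * (8 * n ^ 2 * B + 8 * A ^ 2 * n ^ 2 * B) := by
        gcongr
        · exact lintegral_box_primFst_le hm₂ hL₂ hn hB₂ hp₁
        · exact lintegral_box_primSnd_le hm₁ hL₁ hA hn hB₁ hp₂
    _ = 16 * (1 + A ^ 2) * n ^ 2 * B := by ring


/-! ### Transfer to the Euclidean plane -/

/-- Cartesian coordinates on the plane. -/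
noncomputable def coords : Plane ≃L[ℝ] ℝ × ℝ :=
  (PiLp.continuousLinearEquiv 2 ℝ fun _ : Fin 2 => ℝ).trans (ContinuousLinearEquiv.finTwoArrow ℝ ℝ)

theorem coords_apply (x : Plane) : coords x = (x 0, x 1) := rfl

theorem coords_symm_apply_zero (z : ℝ × ℝ) : coords.symm z 0 = z.1 := rfl

theorem coords_symm_apply_one (z : ℝ × ℝ) : coords.symm z 1 = z.2 := rfl

theorem measurePreserving_coords : MeasurePreserving coords volume volume :=
  (volume_preserving_finTwoArrow ℝ).comp (PiLp.volume_preserving_ofLp (Fin 2))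

theorem measurableEmbedding_coords : MeasurableEmbedding coords :=
  coords.toHomeomorph.measurableEmbedding

theorem integral_coords {E : Type*} [NormedAddCommGroup E] [NormedSpace ℝ E] (F : ℝ × ℝ → E) :
    ∫ x, F (coords x) = ∫ z, F z :=
  measurePreserving_coords.integral_comp measurableEmbedding_coords F

theorem integrable_coords {E : Type*} [NormedAddCommGroup E] (F : ℝ × ℝ → E) :
    Integrable (fun x => F (coords x)) ↔ Integrable F :=
  measurePreserving_coords.integrable_comp_emb measurableEmbedding_coords

theorem setLIntegral_coords (F : ℝ × ℝ → ℝ≥0∞) (S : Set (ℝ × ℝ)) :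
    ∫⁻ x in coords ⁻¹' S, F (coords x) = ∫⁻ z in S, F z :=
  measurePreserving_coords.setLIntegral_comp_preimage_emb measurableEmbedding_coords F S

theorem abs_apply_le_norm (x : Plane) (i : Fin 2) : |x i| ≤ ‖x‖ := PiLp.norm_apply_le x i

theorem norm_le_of_abs_le {x : Plane} {r : ℝ} (hr : 0 < r) (h0 : |x 0| ≤ r / 2)
    (h1 : |x 1| ≤ r / 2) : ‖x‖ < r := by
  rw [EuclideanSpace.norm_eq, Real.sqrt_lt' hr, Fin.sum_univ_two, Real.norm_eq_abs,
    Real.norm_eq_abs]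
  nlinarith [abs_nonneg (x 0), abs_nonneg (x 1)]

/-- The half-diagonal of a unit square is less than 1, so cell energies are bounded by `localNorm`.
-/
theorem preimage_cell_subset (p : ℝ × ℝ) :
    coords ⁻¹' cell p ⊆ Metric.ball (coords.symm p) 1 := by
  intro x hx
  have h0 := hx.1
  have h1 := hx.2
  simp only [coords_apply, Set.mem_Icc] at h0 h1
  rw [mem_ball_iff_norm]
  refine norm_le_of_abs_le one_pos ?_ ?_
  · rw [PiLp.sub_apply, coords_symm_apply_zero, abs_le]
    constructor <;> linarith [h0.1, h0.2]
  · rw [PiLp.sub_apply, coords_symm_apply_one, abs_le]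
    constructor <;> linarith [h1.1, h1.2]

theorem ball_subset_preimage_box (x₀ : Plane) :
    Metric.ball x₀ 1 ⊆ coords ⁻¹' box (coords x₀) := by
  intro x hx
  rw [mem_ball_iff_norm] at hx
  have h0 := abs_le.1 ((abs_apply_le_norm (x - x₀) 0).trans hx.le)
  have h1 := abs_le.1 ((abs_apply_le_norm (x - x₀) 1).trans hx.le)
  simp only [PiLp.sub_apply] at h0 h1
  refine ⟨⟨?_, ?_⟩, ?_, ?_⟩ <;> simp only [coords_apply] <;> linarith [h0.1, h0.2, h1.1, h1.2]

theorem localNorm_sq (u : Plane → Plane) (x₀ : Plane) :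
    localNorm u x₀ ^ 2 = ∫⁻ x in Metric.ball x₀ 1, ‖u x‖ₑ ^ 2 := by
  have h := eLpNorm_nnreal_pow_eq_lintegral (f := u) (μ := volume.restrict (Metric.ball x₀ 1))
    (p := 2) two_ne_zero
  simpa [localNorm] using h

/-- The first coordinate vector. -/
noncomputable def e₁ : Plane := coords.symm (1, 0)

/-- The second coordinate vector. -/
noncomputable def e₂ : Plane := coords.symm (0, 1)

theorem eq_smul_add_smul (x : Plane) : x = x 0 • e₁ + x 1 • e₂ := by
  apply coords.injective
  simp [e₁, e₂, coords_apply]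
  constructor <;> simp [coords_symm_apply_zero, coords_symm_apply_one]

theorem clm_apply_eq (T : Plane →L[ℝ] ℝ) (x : Plane) : T x = x 0 * T e₁ + x 1 * T e₂ := by
  conv_lhs => rw [eq_smul_add_smul x]
  simp

theorem fderiv_comp_coords {g : ℝ × ℝ → ℝ} (hg : ContDiff ℝ ∞ g) (x w : Plane) :
    fderiv ℝ (fun x => g (coords x)) x w = fderiv ℝ g (coords x) (coords w) := by
  have h := (hg.differentiable (by simp) (coords x)).hasFDerivAt.comp x coords.hasFDerivAt
  erw [h.fderiv]
  rfl

theorem fderiv_comp_coords_symm {g : Plane → ℝ} (hg : ContDiff ℝ ∞ g) (z w : ℝ × ℝ) :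
    fderiv ℝ (fun z => g (coords.symm z)) z w = fderiv ℝ g (coords.symm z) (coords.symm w) := by
  have h := (hg.differentiable (by simp) (coords.symm z)).hasFDerivAt.comp z
    coords.symm.hasFDerivAt
  erw [h.fderiv]
  rfl

/-- A divergence-free planar field has a stream function `ψ`, with weak derivatives
`∂₁ψ = u₂` and `∂₂ψ = -u₁`, whose growth is controlled by sums of local energies of the field
over lines of unit squares. -/
theorem exists_stream_function :
    ∃ K : ℝ≥0, ∀ u : Plane → Plane, IsDivFree u → ∃ ψ : Plane → ℝ, Measurable ψ ∧
      (∀ h : Plane → ℝ, Continuous h → HasCompactSupport h → Integrable fun x => ψ x * h x) ∧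
      (∀ g : Plane → ℝ, ContDiff ℝ ∞ g → HasCompactSupport g →
        ∫ x, ψ x * fderiv ℝ g x e₁ = -∫ x, u x 1 * g x) ∧
      (∀ g : Plane → ℝ, ContDiff ℝ ∞ g → HasCompactSupport g →
        ∫ x, ψ x * fderiv ℝ g x e₂ = ∫ x, u x 0 * g x) ∧
      ∀ (n : ℕ) (B : ℝ≥0∞), 1 ≤ n →
        (∀ c : ℝ, ∑ k ∈ Finset.Ico (-(n : ℤ)) n,
          localNorm u (coords.symm (c, (k : ℝ) + 1 / 2)) ^ 2 ≤ n * B) →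
        (∀ c : ℝ, ∑ k ∈ Finset.Ico (-(n : ℤ)) n,
          localNorm u (coords.symm ((k : ℝ) + 1 / 2, c)) ^ 2 ≤ n * B) →
        ∀ x₀ : Plane, ‖x₀‖ + 1 ≤ n →
          ∫⁻ x in Metric.ball x₀ 1, ‖ψ x‖ₑ ^ 2 ≤ K * n ^ 2 * B := by
  obtain ⟨A, hA⟩ := exists_bound_deriv_step
  refine ⟨16 * (1 + A ^ 2), fun u hu => ?_⟩
  -- Line integrals and Fubini are applied to a measurable representative; all conclusions are
  -- insensitive to null sets.
  obtain ⟨u', hu'm, hu'⟩ := hu.locallyIntegrable.aestronglyMeasurable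
  have hmeas : Measurable fun z => coords (u' (coords.symm z)) :=
    coords.continuous.measurable.comp (hu'm.measurable.comp coords.symm.continuous.measurable)
  have hm₁ : Measurable fun z => u' (coords.symm z) 0 := measurable_fst.comp hmeas
  have hm₂ : Measurable fun z => u' (coords.symm z) 1 := measurable_snd.comp hmeas
  have hint : ∀ (i : Fin 2) (n : ℕ), IntegrableOn (fun z => u' (coords.symm z) i) (square n) := by
    intro i n
    have h1 : IntegrableOn u (coords ⁻¹' square n) :=
      hu.locallyIntegrable.integrableOn_isCompact
        (coords.toHomeomorph.isCompact_preimage.2 (isCompact_square n))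
    have h2 : IntegrableOn u' (coords ⁻¹' square n) :=
      h1.congr (ae_restrict_of_ae hu')
    have h3 : IntegrableOn (fun x => u' x i) (coords ⁻¹' square n) :=
      (EuclideanSpace.proj i : Plane →L[ℝ] ℝ).integrable_comp h2
    have h4 := (measurePreserving_coords.integrableOn_comp_preimage measurableEmbedding_coords
      (f := fun z => u' (coords.symm z) i) (s := square n)).1
    exact h4 (by simpa [Function.comp_def] using h3)
  have hdiv : ∀ g : ℝ × ℝ → ℝ, ContDiff ℝ ∞ g → HasCompactSupport g →
      ∫ z, (u' (coords.symm z) 0 * fderiv ℝ g z (1, 0) +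
        u' (coords.symm z) 1 * fderiv ℝ g z (0, 1)) = 0 := by
    intro g hg hc
    refine Eq.trans ?_ (hu.integral_eq_zero _ (hg.comp coords.contDiff)
      (hc.comp_homeomorph coords.toHomeomorph))
    rw [← integral_coords]
    refine integral_congr_ae (hu'.mono fun x hx => ?_)
    dsimp only
    rw [coords.symm_apply_apply, ← hx, clm_apply_eq _ (u x)]
    erw [fderiv_comp_coords hg, fderiv_comp_coords hg]
    simp [e₁, e₂]
  have hL : ∀ (i : Fin 2) (p : ℝ × ℝ), ∫⁻ z in cell p, ‖u' (coords.symm z) i‖ₑ ^ 2 ≤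
      localNorm u (coords.symm p) ^ 2 := by
    intro i p
    rw [localNorm_sq, ← setLIntegral_coords]
    refine (lintegral_mono_set (preimage_cell_subset p)).trans
      (lintegral_mono_ae (ae_restrict_of_ae (hu'.mono fun x hx => ?_)))
    dsimp only
    rw [coords.symm_apply_apply, hx]
    gcongr
    exact enorm_le_iff_norm_le.2 (PiLp.norm_apply_le _ i)
  refine ⟨fun x => stream (fun z => u' (coords.symm z) 0) (fun z => u' (coords.symm z) 1) (coords x),
    (measurable_stream hm₁ hm₂).comp coords.continuous.measurable, ?_, ?_, ?_, ?_⟩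
  · intro h hh hc
    have := (integral_stream_mul hm₁ hm₂ (hint 0) (hint 1) (hh.comp coords.symm.continuous)
      (hc.comp_homeomorph coords.symm.toHomeomorph)).1
    rw [← integrable_coords] at this
    simpa using this
  · intro g hg hc
    have := integral_stream_mul_fderiv_fst hm₁ hm₂ (hint 0) (hint 1)
      (hg.comp coords.symm.contDiff) (hc.comp_homeomorph coords.symm.toHomeomorph)
    rw [← integral_coords, ← integral_coords] at this
    have h2 : ∫ x, u x 1 * g x = ∫ x, u' x 1 * g x :=
      integral_congr_ae (hu'.mono fun x hx => by simp only [hx])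
    rw [h2]
    convert! this using 2
    · funext x
      erw [fderiv_comp_coords_symm hg, coords.symm_apply_apply]
      rfl
    · simp
  · intro g hg hc
    have := integral_stream_mul_fderiv_snd hm₁ hm₂ (hint 0) (hint 1) hdiv
      (hg.comp coords.symm.contDiff) (hc.comp_homeomorph coords.symm.toHomeomorph)
    rw [← integral_coords, ← integral_coords] at this
    have h2 : ∫ x, u x 0 * g x = ∫ x, u' x 0 * g x :=
      integral_congr_ae (hu'.mono fun x hx => by simp only [hx])
    rw [h2]
    convert! this using 2
    · funext x
      erw [fderiv_comp_coords_symm hg, coords.symm_apply_apply]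
      rfl
    · simp
  · intro n B hn hB₁ hB₂ x₀ hx₀
    refine (lintegral_mono_set (ball_subset_preimage_box x₀)).trans ?_
    rw [setLIntegral_coords fun z => ‖stream (fun z => u' (coords.symm z) 0)
      (fun z => u' (coords.symm z) 1) z‖ₑ ^ 2]
    have := lintegral_box_stream_le (p := coords x₀) hm₁ hm₂ (hL 0) (hL 1) hA hn hB₁ hB₂
      (by rw [coords_apply]; exact (add_le_add_left (abs_apply_le_norm x₀ 0) 1).trans hx₀)
      (by rw [coords_apply]; exact (add_le_add_left (abs_apply_le_norm x₀ 1) 1).trans hx₀)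
    push_cast
    exact this


/-! ### Truncation of the stream function -/

/-- The perpendicular gradient `(-∂₂χ, ∂₁χ)`. -/
noncomputable def perpGrad (χ : Plane → ℝ) (x : Plane) : Plane :=
  coords.symm (-fderiv ℝ χ x e₂, fderiv ℝ χ x e₁)

/-- The field `∇^⊥(χ ψ)`, where `ψ` is a stream function of `u`. -/
noncomputable def truncation (χ ψ : Plane → ℝ) (u : Plane → Plane) (x : Plane) : Plane :=
  χ x • u x + ψ x • perpGrad χ x

theorem norm_e₁ : ‖e₁‖ = 1 := by
  rw [EuclideanSpace.norm_eq, Fin.sum_univ_two]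
  simp [e₁, coords_symm_apply_zero, coords_symm_apply_one]

theorem norm_e₂ : ‖e₂‖ = 1 := by
  rw [EuclideanSpace.norm_eq, Fin.sum_univ_two]
  simp [e₂, coords_symm_apply_zero, coords_symm_apply_one]

theorem norm_perpGrad_le (χ : Plane → ℝ) (x : Plane) : ‖perpGrad χ x‖ ≤ 2 * ‖fderiv ℝ χ x‖ := by
  have h1 := (fderiv ℝ χ x).le_opNorm e₁
  have h2 := (fderiv ℝ χ x).le_opNorm e₂
  rw [norm_e₁, mul_one] at h1
  rw [norm_e₂, mul_one] at h2
  rw [eq_smul_add_smul (perpGrad χ x)]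
  refine (norm_add_le _ _).trans ?_
  rw [norm_smul, norm_smul, norm_e₁, norm_e₂, mul_one, mul_one, perpGrad, coords_symm_apply_zero,
    coords_symm_apply_one, norm_neg]
  linarith

theorem continuous_perpGrad {χ : Plane → ℝ} (hχ : ContDiff ℝ ∞ χ) : Continuous (perpGrad χ) := by
  have h := hχ.continuous_fderiv (by simp)
  exact coords.symm.continuous.comp
    ((h.clm_apply continuous_const).neg.prodMk (h.clm_apply continuous_const))

theorem perpGrad_eq_zero {χ : Plane → ℝ} {x : Plane} (h : fderiv ℝ χ x = 0) :
    perpGrad χ x = 0 := by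
  simp [perpGrad, h]

theorem tsupport_truncation_subset (χ ψ : Plane → ℝ) (u : Plane → Plane) :
    tsupport (truncation χ ψ u) ⊆ tsupport χ := by
  refine closure_minimal (fun x hx => ?_) (isClosed_tsupport χ)
  by_contra h
  refine hx ?_
  have hd : fderiv ℝ χ x = 0 := by
    by_contra h'
    exact h (support_fderiv_subset ℝ h')
  simp [truncation, image_eq_zero_of_notMem_tsupport h, perpGrad_eq_zero hd]

/-- Truncating the stream function cuts off a divergence-free field within the class of
divergence-free fields. -/
theorem integral_fderiv_truncation {u : Plane → Plane} (hu : LocallyIntegrable u)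
    {ψ : Plane → ℝ}
    (hψ : ∀ h : Plane → ℝ, Continuous h → HasCompactSupport h → Integrable fun x => ψ x * h x)
    (h₁ : ∀ g : Plane → ℝ, ContDiff ℝ ∞ g → HasCompactSupport g →
        ∫ x, ψ x * fderiv ℝ g x e₁ = -∫ x, u x 1 * g x)
    (h₂ : ∀ g : Plane → ℝ, ContDiff ℝ ∞ g → HasCompactSupport g →
        ∫ x, ψ x * fderiv ℝ g x e₂ = ∫ x, u x 0 * g x)
    {χ φ : Plane → ℝ} (hχ : ContDiff ℝ ∞ χ) (hφ : ContDiff ℝ ∞ φ) (hφc : HasCompactSupport φ) :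
    ∫ x, fderiv ℝ φ x (truncation χ ψ u x) = 0 := by
  have hd : ∀ e : Plane, ContDiff ℝ ∞ fun x => fderiv ℝ φ x e := fun e =>
    (hφ.fderiv_right (by simp)).clm_apply contDiff_const
  have hg : ∀ e : Plane, ContDiff ℝ ∞ fun x => χ x * fderiv ℝ φ x e := fun e => hχ.mul (hd e)
  have hgc : ∀ e : Plane, HasCompactSupport fun x => χ x * fderiv ℝ φ x e := fun e =>
    HasCompactSupport.mul_left
      ((hφc.fderiv (𝕜 := ℝ)).comp_left (g := fun L : Plane →L[ℝ] ℝ => L e) rfl)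
  have hgd : ∀ (e w : Plane) (x : Plane), fderiv ℝ (fun x => χ x * fderiv ℝ φ x e) x w =
      χ x * fderiv ℝ (fderiv ℝ φ) x w e + fderiv ℝ φ x e * fderiv ℝ χ x w := by
    intro e w x
    have hf2 : HasFDerivAt (fderiv ℝ φ) (fderiv ℝ (fderiv ℝ φ) x) x :=
      ((hφ.fderiv_right (m := ∞) (by simp)).differentiable (by simp) x).hasFDerivAt
    have h := (hχ.differentiable (by simp) x).hasFDerivAt.mul
      (hf2.clm_apply (hasFDerivAt_const e x))
    erw [h.fderiv]
    simp
  have hsymm : ∀ x, fderiv ℝ (fderiv ℝ φ) x e₁ e₂ = fderiv ℝ (fderiv ℝ φ) x e₂ e₁ := fun x =>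
    (hφ.contDiffAt.isSymmSndFDerivAt (by
      simp only [minSmoothness_of_isRCLikeNormedField]
      exact WithTop.coe_le_coe.2 (le_top : (2 : ℕ∞) ≤ ⊤))).eq e₁ e₂
  have hui : ∀ (i : Fin 2) (e : Plane), Integrable fun x => u x i * (χ x * fderiv ℝ φ x e) := by
    intro i e
    have h := hu.integrable_smul_left_of_hasCompactSupport (hg e).continuous (hgc e)
    refine ((EuclideanSpace.proj i : Plane →L[ℝ] ℝ).integrable_comp h).congr
      (Eventually.of_forall fun x => ?_)
    simp [mul_comm]
  have hψi : ∀ e w : Plane, Integrable fun x =>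
      ψ x * fderiv ℝ (fun x => χ x * fderiv ℝ φ x e) x w := fun e w =>
    hψ _ (((hg e).continuous_fderiv (by simp)).clm_apply continuous_const)
      (((hgc e).fderiv (𝕜 := ℝ)).comp_left (g := fun L : Plane →L[ℝ] ℝ => L w) rfl)
  -- The difference `∂₁(χ ∂₂φ) - ∂₂(χ ∂₁φ)` equals `∇φ · ∇^⊥χ`, since the mixed second derivatives
  -- of `φ` cancel. The weak derivatives of `ψ` can then be used with the test functions `χ ∂ᵢφ`.
  have key : ∀ x, fderiv ℝ φ x (truncation χ ψ u x) =
      (u x 0 * (χ x * fderiv ℝ φ x e₁) + u x 1 * (χ x * fderiv ℝ φ x e₂)) +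
      (ψ x * fderiv ℝ (fun x => χ x * fderiv ℝ φ x e₂) x e₁ -
        ψ x * fderiv ℝ (fun x => χ x * fderiv ℝ φ x e₁) x e₂) := by
    intro x
    rw [hgd, hgd, hsymm, truncation, map_add, map_smul, map_smul, clm_apply_eq _ (u x),
      clm_apply_eq _ (perpGrad χ x), perpGrad, coords_symm_apply_zero, coords_symm_apply_one,
      smul_eq_mul, smul_eq_mul]
    ring
  simp only [key]
  have i₁ : Integrable fun x =>
      u x 0 * (χ x * fderiv ℝ φ x e₁) + u x 1 * (χ x * fderiv ℝ φ x e₂) := (hui 0 e₁).add (hui 1 e₂)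
  have i₂ : Integrable fun x => ψ x * fderiv ℝ (fun x => χ x * fderiv ℝ φ x e₂) x e₁ -
      ψ x * fderiv ℝ (fun x => χ x * fderiv ℝ φ x e₁) x e₂ := (hψi e₂ e₁).sub (hψi e₁ e₂)
  rw [integral_add i₁ i₂,
    integral_add (hui 0 e₁) (hui 1 e₂), integral_sub (hψi e₂ e₁) (hψi e₁ e₂),
    h₁ _ (hg e₂) (hgc e₂), h₂ _ (hg e₁) (hgc e₁)]
  ring

theorem exists_cutoff : ∃ D : ℝ≥0, ∀ N : ℕ, ∃ χ : Plane → ℝ, ContDiff ℝ ∞ χ ∧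
    tsupport χ ⊆ Metric.ball 0 (2 * (N : ℝ)) ∧ (∀ x ∈ Metric.ball (0 : Plane) (N : ℝ), χ x = 1) ∧
    (∀ x, ‖χ x‖ ≤ 1) ∧ ∀ x, N * ‖fderiv ℝ χ x‖ ≤ D := by
  -- The outer radius `3/2 < 2` keeps the closed support of the rescaled bump inside the open ball
  -- of radius `2N`. Rescaling one bump makes `D` independent of `N`.
  let b : ContDiffBump (0 : Plane) := ⟨1, 3 / 2, by norm_num, by norm_num⟩
  have hb : ContDiff ℝ ∞ b := b.contDiff
  obtain ⟨D, hD⟩ := (b.hasCompactSupport.fderiv (𝕜 := ℝ)).exists_bound_of_continuous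
    (hb.continuous_fderiv (by simp))
  refine ⟨⟨max D 0, le_max_right _ _⟩, fun N => ?_⟩
  rcases Nat.eq_zero_or_pos N with rfl | hN
  · exact ⟨0, contDiff_const, by simp [tsupport], by simp, by simp, fun x => by
      rw [Nat.cast_zero, zero_mul]
      exact le_max_right _ _⟩
  have hN0 : (0 : ℝ) < N := by exact_mod_cast hN
  have hle : ∀ x : Plane, ‖(N : ℝ)⁻¹ • x‖ = ‖x‖ / N := fun x => by
    rw [norm_smul, norm_inv, Real.norm_of_nonneg hN0.le, inv_mul_eq_div]
  refine ⟨fun x => b ((N : ℝ)⁻¹ • x), hb.comp (contDiff_const_smul _), ?_, ?_, ?_, ?_⟩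
  · have : tsupport (fun x => b ((N : ℝ)⁻¹ • x)) ⊆ Metric.closedBall 0 (3 / 2 * N) := by
      refine closure_minimal (fun x hx => ?_) Metric.isClosed_closedBall
      have h1 : (N : ℝ)⁻¹ • x ∈ Function.support b := hx
      rw [b.support_eq, mem_ball_zero_iff, hle] at h1
      rw [mem_closedBall_zero_iff]
      exact ((div_lt_iff₀ hN0).1 h1).le
    exact this.trans (Metric.closedBall_subset_ball (by linarith))
  · intro x hx
    rw [mem_ball_zero_iff] at hx
    refine b.one_of_mem_closedBall ?_
    rw [mem_closedBall_zero_iff, hle]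
    exact (div_le_one hN0).2 hx.le
  · intro x
    rw [Real.norm_of_nonneg b.nonneg]
    exact b.le_one
  · intro x
    have h := (hb.differentiable (by simp) ((N : ℝ)⁻¹ • x)).hasFDerivAt.comp x
      ((hasFDerivAt_id x).const_smul (N : ℝ)⁻¹)
    erw [h.fderiv]
    rw [ContinuousLinearMap.comp_smul, norm_smul, norm_inv, Real.norm_of_nonneg hN0.le,
      ← mul_assoc, mul_inv_cancel₀ hN0.ne', one_mul]
    exact (hD _).trans (le_max_left _ _)

/-! ### Uniformly local bounds and averages over rows of squares -/

theorem memL2b_of_ulNorm_lt_top {f : Plane → Plane} (hf : AEStronglyMeasurable f volume)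
    (h : ulNorm f < ⊤) : MemL2b f := by
  refine ⟨fun K hK => ?_, h⟩
  have hloc : LocallyIntegrable (fun x => ‖f x‖ ^ 2) volume := by
    intro x
    refine ⟨Metric.ball x 1, Metric.ball_mem_nhds x one_pos, ?_⟩
    have : MemLp f 2 (volume.restrict (Metric.ball x 1)) :=
      ⟨hf.restrict, (le_iSup (localNorm f) x).trans_lt h⟩
    exact (memLp_two_iff_integrable_sq_norm this.1).1 this
  exact (memLp_two_iff_integrable_sq_norm hf.restrict).2 (hloc.integrableOn_isCompact hK)

theorem MemL2b.locallyIntegrable {f : Plane → Plane} (hf : MemL2b f) :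
    LocallyIntegrable f volume := by
  refine (locallyIntegrable_iff).2 fun K hK => ?_
  have : IsFiniteMeasure (volume.restrict K) := isFiniteMeasure_restrict.2 hK.measure_ne_top
  exact (hf.memLp_of_isCompact K hK).integrable one_le_two

/-- At most `2n` terms are bounded by `b`, and the at most `2m` central exceptions by `M`. -/
theorem sum_Ico_le {l : ℤ → ℝ≥0∞} {b M : ℝ≥0∞} {m : ℕ} (hM : ∀ k, l k ≤ M)
    (hb : ∀ k ∉ Finset.Ico (-(m : ℤ)) m, l k ≤ b) (n : ℕ) :
    ∑ k ∈ Finset.Ico (-(n : ℤ)) n, l k ≤ 2 * n * b + 2 * m * M := by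
  have hcard : ∀ j : ℕ, ((Finset.Ico (-(j : ℤ)) j).card : ℝ≥0∞) = 2 * j := fun j => by
    rw [Int.card_Ico, sub_neg_eq_add, ← two_mul, show (2 * (j : ℤ)).toNat = 2 * j by omega]
    push_cast
    rfl
  calc ∑ k ∈ Finset.Ico (-(n : ℤ)) n, l k
      ≤ ∑ k ∈ Finset.Ico (-(n : ℤ)) n, (b + if k ∈ Finset.Ico (-(m : ℤ)) m then M else 0) := by
        refine Finset.sum_le_sum fun k _ => ?_
        split_ifs with hk
        · exact (hM k).trans le_add_self
        · exact (hb k hk).trans le_self_add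
    _ ≤ 2 * n * b + 2 * m * M := by
        rw [Finset.sum_add_distrib, Finset.sum_const, nsmul_eq_mul, hcard, Finset.sum_ite,
          Finset.sum_const_zero, add_zero, Finset.sum_const, nsmul_eq_mul, ← hcard m]
        gcongr
        exact fun k hk => (Finset.mem_filter.1 hk).2

/-- The decay of the cutoff gradient cancels the growth of `ψ`: `2 (2D/N)² · K (5N)² B = 200 D² K
B`. -/
theorem localNorm_truncation_sq_le {χ ψ : Plane → ℝ} {u : Plane → Plane} {N : ℕ} (hN : 1 ≤ N)
    {D K : ℝ≥0} {B : ℝ≥0∞} (hψ : Measurable ψ) (hχ1 : ∀ x, ‖χ x‖ ≤ 1)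
    (hχD : ∀ x, N * ‖fderiv ℝ χ x‖ ≤ D) {x₀ : Plane}
    (h : ∫⁻ x in Metric.ball x₀ 1, ‖ψ x‖ₑ ^ 2 ≤ K * (5 * N : ℕ) ^ 2 * B) :
    localNorm (truncation χ ψ u) x₀ ^ 2 ≤ 2 * localNorm u x₀ ^ 2 + 200 * D ^ 2 * K * B := by
  have hN0 : (0 : ℝ) < N := by exact_mod_cast hN
  have hN0' : (N : ℝ≥0) ≠ 0 := by exact_mod_cast hN0.ne'
  have hpt : ∀ x, ‖truncation χ ψ u x‖ₑ ≤ ‖u x‖ₑ + (2 * D / N : ℝ≥0) * ‖ψ x‖ₑ := by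
    intro x
    have h1 : ‖truncation χ ψ u x‖₊ ≤ ‖u x‖₊ + (2 * D / N : ℝ≥0) * ‖ψ x‖₊ := by
      rw [← NNReal.coe_le_coe]
      push_cast
      refine (norm_add_le _ _).trans ?_
      rw [norm_smul, norm_smul, mul_comm _ ‖ψ x‖]
      gcongr
      · exact mul_le_of_le_one_left (norm_nonneg _) (hχ1 x)
      · rw [le_div_iff₀ hN0]
        nlinarith [norm_perpGrad_le χ x, hχD x]
    rw [enorm_eq_nnnorm, enorm_eq_nnnorm, enorm_eq_nnnorm]
    exact_mod_cast h1
  calc localNorm (truncation χ ψ u) x₀ ^ 2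
      = ∫⁻ x in Metric.ball x₀ 1, ‖truncation χ ψ u x‖ₑ ^ 2 := localNorm_sq _ _
    _ ≤ ∫⁻ x in Metric.ball x₀ 1, (2 * ‖u x‖ₑ ^ 2 + 2 * (2 * D / N : ℝ≥0) ^ 2 * ‖ψ x‖ₑ ^ 2) := by
        refine lintegral_mono fun x => (pow_le_pow_left' (hpt x) 2).trans
          ((ennreal_add_sq_le _ _).trans_eq ?_)
        ring
    _ = 2 * localNorm u x₀ ^ 2 +
          2 * (2 * D / N : ℝ≥0) ^ 2 * ∫⁻ x in Metric.ball x₀ 1, ‖ψ x‖ₑ ^ 2 := by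
        have hm : Measurable fun x => ‖ψ x‖ₑ ^ 2 := hψ.enorm.pow_const 2
        rw [lintegral_add_right _ (hm.const_mul _), lintegral_const_mul _ hm,
          lintegral_const_mul' _ _ ENNReal.ofNat_ne_top, localNorm_sq]
    _ ≤ 2 * localNorm u x₀ ^ 2 +
          2 * (2 * D / N : ℝ≥0) ^ 2 * (K * (5 * N : ℕ) ^ 2 * B) := by gcongr
    _ = 2 * localNorm u x₀ ^ 2 + 200 * D ^ 2 * K * B := by
        have h2 : 2 * (2 * D / N) ^ 2 * (K * (5 * N : ℕ) ^ 2) = 200 * D ^ 2 * K := by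
          push_cast
          field_simp
          ring
        rw [← mul_assoc (2 * _)]
        congr 2
        exact_mod_cast h2

theorem localNorm_eq_zero_of_tsupport_subset {f : Plane → Plane} {r : ℝ}
    (hf : tsupport f ⊆ Metric.ball 0 r) {x₀ : Plane} (hx₀ : r + 1 ≤ ‖x₀‖) :
    localNorm f x₀ = 0 := by
  have h : localNorm f x₀ ^ 2 = 0 := by
    rw [localNorm_sq]
    refine setLIntegral_eq_zero Metric.isOpen_ball.measurableSet fun x hx => ?_
    have : x ∉ tsupport f := fun h => by
      have h1 := mem_ball_zero_iff.1 (hf h)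
      rw [mem_ball_iff_norm'] at hx
      linarith [norm_le_norm_add_norm_sub' x₀ x]
    simp [image_eq_zero_of_notMem_tsupport this]
  simpa using h

theorem aestronglyMeasurable_truncation {χ ψ : Plane → ℝ} {u : Plane → Plane}
    (hχ : ContDiff ℝ ∞ χ) (hψ : Measurable ψ) (hu : AEStronglyMeasurable u volume) :
    AEStronglyMeasurable (truncation χ ψ u) volume :=
  (hχ.continuous.aestronglyMeasurable.smul hu).add
    (hψ.aestronglyMeasurable.smul (continuous_perpGrad hχ).aestronglyMeasurable)

/-- Far cells contribute at most `2n · η/4 = nη/2`; the near ones are at most `2m` in number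
whatever the position of the line, so their share `2mM` is below `nη/2` for large `n`. Hence `n₀`
does not depend on `p`. -/
theorem exists_nat_sum_le {l : Plane → ℝ≥0∞} {M η : ℝ≥0} (hM : ∀ x, l x ≤ M) (hη : 0 < η)
    {m : ℕ} (hl : ∀ x : Plane, (m : ℝ) ≤ ‖x‖ → l x ≤ (η / 2 / 2 : ℝ≥0)) :
    ∃ n₀ : ℕ, ∀ n : ℕ, n₀ ≤ n → ∀ p : ℤ → Plane, (∀ k : ℤ, |(k : ℝ) + 1 / 2| ≤ ‖p k‖) →
      ∑ k ∈ Finset.Ico (-(n : ℤ)) n, l (p k) ≤ n * (η : ℝ≥0∞) := by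
  obtain ⟨n₀, hn₀⟩ := exists_nat_ge (2 * m * M / (η / 2))
  refine ⟨n₀, fun n hn p hp => ?_⟩
  refine (sum_Ico_le (m := m) (fun k => hM _) (fun k hk => hl _ ((?_ : _ ≤ _).trans (hp k))) n).trans
    ?_
  · rw [Finset.mem_Ico, not_and_or, not_le, not_lt] at hk
    rcases hk with hk | hk
    · have : (k : ℝ) + 1 ≤ -m := by exact_mod_cast hk
      rw [le_abs]
      right
      linarith
    · have : (m : ℝ) ≤ k := by exact_mod_cast hk
      rw [le_abs]
      left
      linarith
  · have h1 : 2 * m * M ≤ n * (η / 2) := by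
      rw [← div_le_iff₀ (half_pos hη)]
      exact hn₀.trans (by exact_mod_cast hn)
    have h2 : 2 * n * (η / 2 / 2) + 2 * m * M ≤ n * η := by
      calc 2 * n * (η / 2 / 2) + 2 * m * M ≤ 2 * n * (η / 2 / 2) + n * (η / 2) := by gcongr
        _ = n * (η / 2 + η / 2) := by ring
        _ = n * η := by rw [add_halves]
    exact_mod_cast h2

theorem exists_pos_mul_sq_add_le {δ L : ℝ≥0} (hδ : 0 < δ) :
    ∃ η : ℝ≥0, 0 < η ∧ 2 * η ^ 2 + L * η ≤ δ ^ 2 := by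
  refine ⟨min 1 (δ ^ 2 / (2 + L)), lt_min one_pos (by positivity), ?_⟩
  set η := min 1 (δ ^ 2 / (2 + L))
  have h1 : η ≤ 1 := min_le_left _ _
  have h2 : η * (2 + L) ≤ δ ^ 2 := by
    rw [← le_div_iff₀ (by positivity)]
    exact min_le_right _ _
  calc 2 * η ^ 2 + L * η = 2 * (η * η) + L * η := by ring
    _ ≤ 2 * (1 * η) + L * η := by gcongr
    _ = η * (2 + L) := by ring
    _ ≤ δ ^ 2 := h2

end UniformlyLocal


/-! ### The main theorem -/

open UniformlyLocal in
theorem mainTheorem10 :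
    ∃ C : ℝ≥0, ∀ u : UniformlyLocal.Plane → UniformlyLocal.Plane,
      UniformlyLocal.MemL2b u → UniformlyLocal.IsDivFree u →
      ∃ uN : ℕ → UniformlyLocal.Plane → UniformlyLocal.Plane,
        (∀ N : ℕ,
          UniformlyLocal.MemL2b (uN N) ∧
          UniformlyLocal.IsDivFree (uN N) ∧
          UniformlyLocal.ulNorm (uN N) ≤ (C : ℝ≥0∞) * UniformlyLocal.ulNorm u ∧
          tsupport (uN N) ⊆ Metric.ball 0 (2 * (N : ℝ)) ∧
          (∀ x ∈ Metric.ball (0 : UniformlyLocal.Plane) (N : ℝ), uN N x = u x)) ∧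
        (UniformlyLocal.MemL2bDot u →
          ∀ ε : ℝ, 0 < ε → ∃ R : ℝ, ∀ x₀ : UniformlyLocal.Plane, R ≤ ‖x₀‖ →
            ∀ N : ℕ, UniformlyLocal.localNorm (uN N) x₀ ≤ ENNReal.ofReal ε) := by
  obtain ⟨K, hK⟩ := exists_stream_function
  obtain ⟨D, hD⟩ := exists_cutoff
  choose χ hχ hχsupp hχ1 hχle hχD using hD
  refine ⟨2 + 400 * D ^ 2 * K, fun u hu hdiv => ?_⟩
  obtain ⟨ψ, hψm, hψi, hψ₁, hψ₂, hψB⟩ := hK u hdiv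
  have hum := hdiv.locallyIntegrable.aestronglyMeasurable
  have hsupp : ∀ N : ℕ, tsupport (truncation (χ N) ψ u) ⊆ Metric.ball 0 (2 * (N : ℝ)) := fun N =>
    (tsupport_truncation_subset _ _ _).trans (hχsupp N)
  -- The bounds on row and column sums are required only for `N ≥ 1` and `‖x₀‖ < 2N + 1`, as
  -- otherwise the truncated field vanishes on the unit ball at `x₀`. Both the uniform bound and the
  -- decay are instances of this estimate.
  have hmain : ∀ (N : ℕ) (x₀ : Plane) (B : ℝ≥0∞),
      (1 ≤ N → ‖x₀‖ < 2 * N + 1 →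
        (∀ c : ℝ, ∑ k ∈ Finset.Ico (-((5 * N : ℕ) : ℤ)) (5 * N : ℕ),
          localNorm u (coords.symm (c, (k : ℝ) + 1 / 2)) ^ 2 ≤ (5 * N : ℕ) * B) ∧
        (∀ c : ℝ, ∑ k ∈ Finset.Ico (-((5 * N : ℕ) : ℤ)) (5 * N : ℕ),
          localNorm u (coords.symm ((k : ℝ) + 1 / 2, c)) ^ 2 ≤ (5 * N : ℕ) * B)) →
      localNorm (truncation (χ N) ψ u) x₀ ^ 2 ≤
        2 * localNorm u x₀ ^ 2 + 200 * D ^ 2 * K * B := by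
    intro N x₀ B hB
    rcases Nat.eq_zero_or_pos N with rfl | hN
    · have h0 : truncation (χ 0) ψ u = 0 := by
        rw [← tsupport_eq_empty_iff, ← Set.subset_empty_iff]
        simpa using hsupp 0
      simp [h0, localNorm]
    · rcases le_or_gt (2 * (N : ℝ) + 1) ‖x₀‖ with hx | hx
      · rw [localNorm_eq_zero_of_tsupport_subset (hsupp N) hx]
        simp
      · obtain ⟨hB₁, hB₂⟩ := hB hN hx
        have hN1 : (1 : ℝ) ≤ N := by exact_mod_cast hN
        -- The choice `n = 5N` is large enough: `‖x₀‖ + 1 < 2N + 2 ≤ 5N`.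
        exact localNorm_truncation_sq_le hN hψm (hχle N) (hχD N)
          (hψB (5 * N) B (by omega) hB₁ hB₂ x₀ (by push_cast; linarith))
  have hloc : ∀ x₀, localNorm u x₀ ≤ ulNorm u := le_iSup (localNorm u)
  have hbound : ∀ N, ulNorm (truncation (χ N) ψ u) ≤
      ((2 + 400 * D ^ 2 * K : ℝ≥0) : ℝ≥0∞) * ulNorm u := by
    intro N
    refine iSup_le fun x₀ => ?_
    rw [← ENNReal.pow_le_pow_left_iff two_ne_zero, mul_pow]
    have hs : ∀ p : ℤ → Plane, ∑ k ∈ Finset.Ico (-((5 * N : ℕ) : ℤ)) (5 * N : ℕ),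
        localNorm u (p k) ^ 2 ≤ (5 * N : ℕ) * (2 * ulNorm u ^ 2) := fun p => by
      -- With `m = 0` there are no exceptional cells; each of the `2n` cells is bounded by the full
      -- norm, whence `B = 2 ‖u‖²`.
      have h := sum_Ico_le (l := fun k => localNorm u (p k) ^ 2) (m := 0)
        (fun k => pow_le_pow_left' (hloc (p k)) 2) (fun k _ => pow_le_pow_left' (hloc (p k)) 2)
        (5 * N)
      refine h.trans_eq ?_
      rw [Nat.cast_zero]
      ring
    calc localNorm (truncation (χ N) ψ u) x₀ ^ 2
        ≤ 2 * localNorm u x₀ ^ 2 + 200 * D ^ 2 * K * (2 * ulNorm u ^ 2) :=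
          hmain N x₀ _ fun _ _ => ⟨fun _ => hs _, fun _ => hs _⟩
      _ ≤ 2 * ulNorm u ^ 2 + 200 * D ^ 2 * K * (2 * ulNorm u ^ 2) := by
          gcongr
          exact hloc x₀
      _ = ((2 + 400 * D ^ 2 * K : ℝ≥0) : ℝ≥0∞) * ulNorm u ^ 2 := by
          push_cast
          ring
      -- A constant at least 1 is bounded by its square, so no square root is needed in `C`.
      _ ≤ ((2 + 400 * D ^ 2 * K : ℝ≥0) : ℝ≥0∞) ^ 2 * ulNorm u ^ 2 := by
          gcongr
          refine le_self_pow₀ ?_ two_ne_zero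
          have : (1 : ℝ≥0) ≤ 2 + 400 * D ^ 2 * K := le_add_right one_le_two
          exact_mod_cast this
  have hmem : ∀ N, MemL2b (truncation (χ N) ψ u) := fun N =>
    memL2b_of_ulNorm_lt_top (aestronglyMeasurable_truncation (hχ N) hψm hum)
      ((hbound N).trans_lt (ENNReal.mul_lt_top ENNReal.coe_lt_top hu.ulNorm_lt_top))
  refine ⟨fun N => truncation (χ N) ψ u, fun N => ⟨hmem N, ⟨(hmem N).locallyIntegrable,
    fun φ hφ hφc => integral_fderiv_truncation hdiv.locallyIntegrable hψi hψ₁ hψ₂ (hχ N) hφ hφc⟩,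
    hbound N, hsupp N, fun x hx => ?_⟩, fun hdot ε hε => ?_⟩
  · have hd : fderiv ℝ (χ N) x = 0 := by
      have : χ N =ᶠ[𝓝 x] fun _ => 1 := by
        filter_upwards [Metric.isOpen_ball.mem_nhds hx] with y hy using hχ1 N y hy
      rw [this.fderiv_eq]
      simp
    simp [truncation, hχ1 N x hx, perpGrad_eq_zero hd]
  · lift ε to ℝ≥0 using hε.le
    obtain ⟨η, hη, hηε⟩ := exists_pos_mul_sq_add_le (L := 200 * D ^ 2 * K)
      (NNReal.coe_pos.1 hε)
    have ht : Tendsto (fun x => localNorm u x ^ 2) (cocompact Plane) (𝓝 0) := by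
      simpa using ENNReal.Tendsto.pow (n := 2) hdot.tendsto_zero
    have hev : ∀ᶠ x in cocompact Plane, localNorm u x ≤ η ∧
        localNorm u x ^ 2 ≤ (η / 2 / 2 : ℝ≥0) :=
      (hdot.tendsto_zero.eventually_le_const (by exact_mod_cast hη)).and
        (ht.eventually_le_const (by exact_mod_cast half_pos (half_pos hη)))
    rw [← Metric.cobounded_eq_cocompact, ← comap_norm_atTop, eventually_comap,
      eventually_atTop] at hev
    obtain ⟨r, hr⟩ := hev
    obtain ⟨m, hm⟩ := exists_nat_ge r
    have hM := ENNReal.coe_toNNReal (ENNReal.pow_ne_top (n := 2) hu.ulNorm_lt_top.ne)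
    obtain ⟨n₀, hn₀⟩ := exists_nat_sum_le (l := fun x => localNorm u x ^ 2) (M := (ulNorm u ^ 2).toNNReal) (m := m)
      (fun x => (pow_le_pow_left' (hloc x) 2).trans_eq hM.symm) hη
      (fun x hx => (hr ‖x‖ (hm.trans hx) x rfl).2)
    -- Beyond `m` the local norm of `u` is at most `η`. Beyond `n₀ + 1`, any `N` with `‖x₀‖ < 2N +
    -- 1` satisfies `n₀ < 2N + 1`, so row and column averages at scale `5N` are already small.
    refine ⟨max m (n₀ + 1), fun x₀ hx₀ N => ?_⟩
    rw [ENNReal.ofReal_coe_nnreal, ← ENNReal.pow_le_pow_left_iff two_ne_zero]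
    have hN : ‖x₀‖ < 2 * N + 1 → n₀ ≤ 5 * N := fun h => by
      have : (n₀ : ℝ) ≤ (5 * N : ℕ) := by
        push_cast
        linarith [(le_max_right (m : ℝ) _).trans hx₀, (Nat.cast_nonneg N : (0 : ℝ) ≤ N)]
      exact_mod_cast this
    calc localNorm (truncation (χ N) ψ u) x₀ ^ 2
        ≤ 2 * localNorm u x₀ ^ 2 + 200 * D ^ 2 * K * η :=
          hmain N x₀ _ fun _ hx => ⟨fun c => hn₀ _ (hN hx) _ fun k =>
            abs_apply_le_norm (coords.symm (c, (k : ℝ) + 1 / 2)) 1,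
            fun c => hn₀ _ (hN hx) _ fun k =>
            abs_apply_le_norm (coords.symm ((k : ℝ) + 1 / 2, c)) 0⟩
      _ ≤ 2 * (η : ℝ≥0∞) ^ 2 + 200 * D ^ 2 * K * η := by
          gcongr
          exact (hr ‖x₀‖ (hm.trans ((le_max_left _ _).trans hx₀)) x₀ rfl).1
      _ ≤ (ε : ℝ≥0∞) ^ 2 := by exact_mod_cast hηε
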